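/- Let $p$ be a prime and $m\ge 1$ an integer with $(p,m)\neq(2,6)$. For $1\le k\le m-1$, $q=p^k$ and $\alpha,a,b\in\mathbb F_{p^m}$ such that $-\alpha$ is not a $(q-1)$-st power in $\mathbb F_{p^m}$ and the polynomial $x^{q+1}+ax+b$ has no root in $\mathbb F_{p^m}$, the Taniguchi pre-semifield $T(q,\alpha,a,b)$ is $\mathbb F_{p^m}\times\mathbb F_{p^m}$ with componentwise addition and the multiplication $$(x,y)\circ(u,v)=\bigl(x^qu+\alpha^{q^2}xu^q-a(xv^q-\alpha^q uy^q)-b(y^qv+\alpha yv^q),\ xv^{q^2}+y^{q^2}u\bigr).$$ Two pre-semifields with multiplications $\circ_1,\circ_2$ on the same $\mathbb F_p$-vector space are isotopic if there are $\mathbb F_p$-linear bijections $N,L,M$ of that space with $N(X\circ_1 Y)=L(X)\circ_2 M(Y)$ for all $X,Y$. Let $\mathbb P_1=T(p^{k_1},\alpha,a,b)$ and $\mathbb P_2=T(p^{k_2},\alpha',a',b')$ be Taniguchi pre-semifields on $\mathbb F_{p^m}\times\mathbb F_{p^m}$ with $k_1\neq m/2$ and $a,a'\in\{0,1\}$. 1.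 If $k_2\equiv -k_1 \pmod m$, then for fixed $\alpha',a',b'$ there exist $\alpha,a,b$ (with $a\in\{0,1\}$ and $T(p^{k_1},\alpha,a,b)$ a Taniguchi pre-semifield) such that $\mathbb P_1$ and $\mathbb P_2$ are isotopic. 2. If $k_1\not\equiv k_2 \pmod m$ and $k_1\not\equiv -k_2\pmod m$, then $\mathbb P_1$ and $\mathbb P_2$ are not isotopic. 3. If $k_1=k_2=k$ and $q=p^k$, then $T(q,\alpha,a,b)$ and $T(q,\alpha',a',b')$ are isotopic if and only if one of the following two cases occurs: - $a=a'=0$, and for some $0\le t\le m-1$ both $\alpha^{p^t}/\alpha'$ is a $(q-1)$-st power in $\mathbb F_{p^m}^*$ and $b'^{\,p^{m-t}}/b$ is a $(q+1)$-st power in $\mathbb F_{p^m}^*$; - $a=a'=1$, and for some $0\le t\le m-1$ both $\alpha^{p^t}/\alpha'$ is a $(q-1)$-st power in $\mathbb F_{p^m}^*$ and $b=b'^{\,p^{m-t}}$. -/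

import Mathlib

/-- Two multiplications on an `𝔽_p`-vector space `V` are isotopic if there are `𝔽_p`-linear
bijections `N`, `L`, `M` of `V` with `N (x ∘₁ y) = L x ∘₂ M y` for all `x`, `y`. -/
def Isotopic (p : ℕ) {V : Type*} [AddCommGroup V] [Module (ZMod p) V]
    (mul₁ mul₂ : V → V → V) : Prop :=
  ∃ N L M : V ≃ₗ[ZMod p] V, ∀ x y : V, N (mul₁ x y) = mul₂ (L x) (M y)

/-- The multiplication of `T(q, α, a, b)` on `F × F`, with `(x, y) = P` and `(u, v) = Q`:
`(x^q u + α^{q²} x u^q - a (x v^q - α^q u y^q) - b (y^q v + α y v^q), x v^{q²} + y^{q²} u)`. -/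
def taniguchiMul {F : Type*} [Field F] (q : ℕ) (α a b : F) (P Q : F × F) : F × F :=
  (P.1 ^ q * Q.1 + α ^ (q ^ 2) * P.1 * Q.1 ^ q
      - a * (P.1 * Q.2 ^ q - α ^ q * Q.1 * P.2 ^ q)
      - b * (P.2 ^ q * Q.2 + α * P.2 * Q.2 ^ q),
    P.1 * Q.2 ^ (q ^ 2) + P.2 ^ (q ^ 2) * Q.1)

/-- The admissible parameters of a Taniguchi pre-semifield `T(p^k, α, a, b)` on `F × F`, where
`F` has `p^m` elements. (Taking `z = 0` and `x = 0` below, one gets `α ≠ 0` and `b ≠ 0`.) -/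
structure IsTaniguchi (p m k : ℕ) {F : Type*} [Field F] (α a b : F) : Prop where
  one_le : 1 ≤ k
  le_sub_one : k ≤ m - 1
  not_pow : ¬ ∃ z : F, z ^ (p ^ k - 1) = -α
  no_root : ∀ x : F, x ^ (p ^ k + 1) + a * x + b ≠ 0

/-! Write σ for x ↦ x^q. Multiplying both factors by the same nonzero scalar is an autotopism. Since
2k ≠ m forces m ≥ 3, and (p, m) ≠ (2, 6), Zsigmondy's theorem supplies a prime R modulo which p has
order m. The R-part S of the scalars is then a Sylow R-subgroup of the autotopism group. Indeed, an
autotopism of R-power order normalizing S is semilinear, because an element of order R generates F.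
It is linear because R is prime to m, and the coefficient comparison below then shows it to be a
scalar (`exists_scalarPair_eq_of_normalizes`). An isotopism transports the scalars of one
pre-semifield to autotopisms of the other. After a Sylow conjugation its L and M are therefore
semilinear for one common Frobenius power, and twisting the parameters by that power makes L and M
linear over F (`exists_linear_isotopism`).

For linear L and M, expand N in Frobenius powers, scale the arguments to xX and uY, and compare
coefficients of x^(p^i) u^(p^j). The left side lives on the diagonals i - j = ±k₁, ±2k₁; the right
side occupies only two positions in each coordinate. If k₂ ≠ ±k₁, this forces N or L to kill a
nonzero vector (`not_isotopism_of_linear`). If the exponents agree, N has very few terms, and the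
rank-one forms in the second coordinate make L and M both diagonal or both antidiagonal
(`diag_or_antidiag`). Their entries yield the relation `ParamRel` between the parameters.

Conversely, diagonal semilinear maps realize `ParamRel`, and a coordinate swap combined with
Frobenius inverses realizes opposite exponents. -/

/-- The `i`-th power of the Frobenius automorphism of a field with `p ^ m` elements, with the
exponent `i` taken modulo `m`. -/
noncomputable def fr (F : Type*) [Field F] (p : ℕ) [Fact p.Prime] [CharP F p] {m : ℕ} (i : ZMod m) :
    F →+* F :=
  iterateFrobenius F p i.val

/-! ### Frobenius powers, linearized polynomials and their two-variable analogues. -/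

section Frobenius

set_option linter.unusedSectionVars false

variable {F : Type*} [Field F] {p m : ℕ} [Fact p.Prime] [CharP F p] [NeZero m]
  [Fact (Nat.card F = p ^ m)]

theorem fr_apply (i : ZMod m) (x : F) : fr F p i x = x ^ p ^ i.val := rfl

theorem finite_of_card (F : Type*) (p m : ℕ) [hp : Fact p.Prime] [hF : Fact (Nat.card F = p ^ m)] :
    Finite F :=
  Nat.finite_of_card_ne_zero (by rw [hF.out]; exact pow_ne_zero _ hp.out.ne_zero)

theorem fr_natCast (k : ℕ) (x : F) : fr F p (k : ZMod m) x = x ^ p ^ k := by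
  have := finite_of_card F p m
  have := Fintype.ofFinite F
  have hF : Nat.card F = p ^ m := Fact.out
  rw [fr_apply, ZMod.val_natCast]
  conv_rhs => rw [← Nat.mod_add_div k m, pow_add, pow_mul, pow_mul, ← hF, Nat.card_eq_fintype_card,
    FiniteField.pow_card_pow]

theorem fr_add (i j : ZMod m) (x : F) : fr F p (i + j) x = fr F p i (fr F p j x) := by
  have h : i + j = ((i.val + j.val : ℕ) : ZMod m) := by simp
  rw [h, fr_natCast, fr_apply, fr_apply, add_comm, pow_add, pow_mul]

theorem fr_zero (x : F) : fr F p (0 : ZMod m) x = x := by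
  simp [fr_apply]

theorem fr_neg_fr (i : ZMod m) (x : F) : fr F p (-i) (fr F p i x) = x := by
  rw [← fr_add, neg_add_cancel, fr_zero]

theorem fr_fr_neg (i : ZMod m) (x : F) : fr F p i (fr F p (-i) x) = x := by
  rw [← fr_add, add_neg_cancel, fr_zero]

theorem fr_two_mul (i : ZMod m) (x : F) : fr F p (2 * i) x = fr F p i (fr F p i x) := by
  rw [two_mul, fr_add]

theorem fr_injective : Function.Injective (fun i : ZMod m => fr F p i) := by
  intro i j hij
  have := finite_of_card F p m
  have := Fintype.ofFinite F
  have hF : Nat.card F = p ^ m := Fact.out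
  obtain ⟨g, hg⟩ := IsCyclic.exists_generator (α := Fˣ)
  have ho : orderOf g = p ^ m - 1 := by
    rw [orderOf_eq_card_of_forall_mem_zpowers hg, Nat.card_units, hF]
  have hp : 1 < p := (Fact.out : p.Prime).one_lt
  have h1 : g ^ p ^ i.val = g ^ p ^ j.val := by
    ext; simpa [fr_apply] using congrArg (fun f : F →+* F => f g) hij
  rw [pow_inj_mod, ho] at h1
  apply ZMod.val_injective
  -- The exponents lie below the order of `g` except over the field with two elements, where there
  -- is only one index.
  have key : ∀ i : ZMod m, p ^ i.val < p ^ m - 1 ∨ (i.val + 1 = m ∧ p = 2 ∧ m = 1) := by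
    intro i
    have hi := ZMod.val_lt i
    have h2 : p ^ (i.val + 1) ≤ p ^ m := Nat.pow_le_pow_right (by omega) hi
    rw [pow_succ] at h2
    have h3 : 1 ≤ p ^ i.val := Nat.one_le_pow _ _ (by omega)
    by_cases hp2 : p = 2
    · subst hp2
      by_cases h4 : i.val = 0
      · rw [h4] at h2 ⊢
        by_cases h5 : m = 1
        · right; omega
        · left
          have : 2 ^ 2 ≤ 2 ^ m := Nat.pow_le_pow_right (by omega) (by omega)
          simp at *; omega
      · have : 2 ^ 1 ≤ 2 ^ i.val := Nat.pow_le_pow_right (by omega) (by omega)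
        left; omega
    · left
      have : p ^ i.val * 3 ≤ p ^ i.val * p := Nat.mul_le_mul_left _ (by omega)
      omega
  rcases key i with h | h
  · rcases key j with h' | h'
    · rw [Nat.mod_eq_of_lt h, Nat.mod_eq_of_lt h'] at h1
      exact Nat.pow_right_injective hp h1
    · have := ZMod.val_lt i; omega
  · have := ZMod.val_lt j; omega

theorem linearIndependent_fr :
    LinearIndependent F (fun (i : ZMod m) => (fun x => fr F p i x : F → F)) :=
  (linearIndependent_monoidHom F F).comp (fun i : ZMod m => ((fr F p i : F →+* F) : F →* F))
    fun _ _ hij => fr_injective (RingHom.ext fun x => DFunLike.congr_fun hij x)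

theorem eq_zero_of_sum_fr (c : ZMod m → F) (h : ∀ x, ∑ i, c i * fr F p i x = 0) (i : ZMod m) :
    c i = 0 := by
  have h1 := Fintype.linearIndependent_iff.mp (linearIndependent_fr (F := F) (p := p) (m := m))
  refine h1 c ?_ i
  ext x
  rw [Finset.sum_apply]
  exact h x

theorem exists_eq_fr [Algebra (ZMod p) F] (m : ℕ) [NeZero m] [Fact (Nat.card F = p ^ m)]
    (τ : F →+* F) : ∃ t : ZMod m, τ = fr F p t := by
  have := finite_of_card F p m
  let τ' : F →ₐ[ZMod p] F := { τ with
    commutes' := fun r => congrArg (fun f : ZMod p →+* F => f r)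
      (Subsingleton.elim (τ.comp (algebraMap (ZMod p) F)) (algebraMap (ZMod p) F)) }
  obtain ⟨n, hn⟩ := (FiniteField.bijective_frobeniusAlgHom_pow (ZMod p) F).2 τ'
  refine ⟨(n.1 : ZMod m), RingHom.ext fun x => ?_⟩
  rw [fr_natCast]
  have := congrArg (fun f : F →ₐ[ZMod p] F => f x) hn
  simp only [AlgHom.coe_pow, FiniteField.coe_frobeniusAlgHom, pow_iterate, ZMod.card] at this
  exact this.symm

/-- The m Frobenius powers are independent over F, and the 𝔽_p-endomorphisms of F form an F-space of
dimension m, so they span it. -/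
theorem exists_fr_coeff [Algebra (ZMod p) F] (f : F →ₗ[ZMod p] F) :
    ∃ n : ZMod m → F, ∀ z, f z = ∑ i, n i * fr F p i z := by
  have := finite_of_card F p m
  have := Fintype.ofFinite F
  have hF : Nat.card F = p ^ m := Fact.out
  let g : ZMod m → (F →ₗ[ZMod p] F) := fun i => (fr F p i).toAddMonoidHom.toZModLinearMap p
  have hg : LinearIndependent F g := by
    apply LinearIndependent.of_comp (LinearMap.ltoFun (ZMod p) F F F)
    exact linearIndependent_fr
  have h2 := Module.card_eq_pow_finrank (K := ZMod p) (V := F)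
  rw [← Nat.card_eq_fintype_card, hF, ZMod.card] at h2
  have h3 := Nat.pow_right_injective (Fact.out : p.Prime).one_lt h2
  have hs := hg.span_eq_top_of_card_eq_finrank' (by
    rw [Module.finrank_linearMap_self, ZMod.card, h3])
  have hf : f ∈ Submodule.span F (Set.range g) := hs ▸ Submodule.mem_top
  rw [Submodule.mem_span_range_iff_exists_fun] at hf
  obtain ⟨c, rfl⟩ := hf
  refine ⟨c, fun z => ?_⟩
  simp [g]

/-- The bi-additive map `(x, u) ↦ ∑ i j, A i j * x ^ p ^ i * u ^ p ^ j`. -/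
noncomputable def bieval (p : ℕ) [Fact p.Prime] [CharP F p] (A : ZMod m → ZMod m → F) (x u : F) : F :=
  ∑ i, ∑ j, A i j * (fr F p i x * fr F p j u)

/-- Independence of the Frobenius powers, used once in each variable. -/
theorem bieval_injective {A B : ZMod m → ZMod m → F} (h : ∀ x u, bieval p A x u = bieval p B x u) :
    A = B := by
  have h1 : ∀ x u : F, ∑ i, (∑ j, (A i j - B i j) * fr F p j u) * fr F p i x = 0 := by
    intro x u
    have := sub_eq_zero.mpr (h x u)
    rw [bieval, bieval, ← Finset.sum_sub_distrib] at this
    rw [← this]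
    refine Finset.sum_congr rfl fun i _ => ?_
    rw [← Finset.sum_sub_distrib, Finset.sum_mul]
    exact Finset.sum_congr rfl fun j _ => by ring
  ext i j
  exact sub_eq_zero.mp (eq_zero_of_sum_fr _
    (fun u => eq_zero_of_sum_fr _ (fun x => h1 x u) i) j)

theorem bieval_add (A B : ZMod m → ZMod m → F) (x u : F) :
    bieval p (A + B) x u = bieval p A x u + bieval p B x u := by
  simp [bieval, ← Finset.sum_add_distrib, add_mul]

/-- The coefficients of `c * x ^ p ^ r * u ^ p ^ s`. -/
def bimonomial (c : F) (r s : ZMod m) : ZMod m → ZMod m → F :=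
  fun i j => if i = r ∧ j = s then c else 0

theorem bieval_bimonomial (c : F) (r s : ZMod m) (x u : F) :
    bieval p (bimonomial c r s) x u = c * (fr F p r x * fr F p s u) := by
  simp [bieval, bimonomial, ite_and]

/-- The coefficients of `∑ i, n i * (d * x ^ p ^ r * u ^ p ^ s) ^ p ^ i`. -/
noncomputable def bicomp (p : ℕ) [Fact p.Prime] [CharP F p] (n : ZMod m → F) (d : F) (r s : ZMod m) :
    ZMod m → ZMod m → F :=
  fun i j => if i - r = j - s then n (i - r) * fr F p (i - r) d else 0

theorem bieval_bicomp (n : ZMod m → F) (d : F) (r s : ZMod m) (x u : F) :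
    bieval p (bicomp p n d r s) x u =
      ∑ i, n i * fr F p i (d * (fr F p r x * fr F p s u)) := by
  rw [bieval, ← Equiv.sum_comp (Equiv.addRight r)]
  refine Finset.sum_congr rfl fun i _ => ?_
  rw [Finset.sum_eq_single (i + s)]
  · simp [bicomp, map_mul, fr_add]; ring
  · intro j _ hj
    rw [bicomp, if_neg, zero_mul]
    simp only [Equiv.coe_addRight, add_sub_cancel_right]
    rintro rfl
    simp at hj
  · simp

end Frobenius

/-! ### Semilinear components of the multiplication, and comparison of coefficients. -/

section Forms

set_option linter.unusedSectionVars false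

variable {F : Type*} [Field F] (p : ℕ) {m : ℕ} [Fact p.Prime] [CharP F p]

/-- The part of the first coordinate of the Taniguchi multiplication that is `p ^ s`-semilinear in
the first and linear in the second argument. -/
noncomputable def formP (s : ZMod m) (α a b : F) (X Y : F × F) : F :=
  fr F p s X.1 * Y.1 + a * fr F p s α * fr F p s X.2 * Y.1 - b * fr F p s X.2 * Y.2

/-- The part of the first coordinate of the Taniguchi multiplication that is linear in the first and
`p ^ s`-semilinear in the second argument. -/
noncomputable def formQ (s : ZMod m) (α a b : F) (X Y : F × F) : F :=
  fr F p (2 * s) α * X.1 * fr F p s Y.1 - a * X.1 * fr F p s Y.2 - b * α * X.2 * fr F p s Y.2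

/-- The part of the second coordinate of the Taniguchi multiplication that is linear in the first
and `p ^ (2 * s)`-semilinear in the second argument. -/
noncomputable def formG (s : ZMod m) (X Y : F × F) : F := X.1 * fr F p (2 * s) Y.2

/-- The part of the second coordinate of the Taniguchi multiplication that is
`p ^ (2 * s)`-semilinear in the first and linear in the second argument. -/
noncomputable def formH (s : ZMod m) (X Y : F × F) : F := fr F p (2 * s) X.2 * Y.1

variable {p} [NeZero m] [Fact (Nat.card F = p ^ m)]

theorem pow_sq_eq_fr (k : ℕ) (x : F) : x ^ ((p ^ k) ^ 2) = fr F p (2 * (k : ZMod m)) x := by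
  have h : (2 * (k : ZMod m)) = ((k * 2 : ℕ) : ZMod m) := by push_cast; ring
  rw [h, fr_natCast, pow_mul]

theorem taniguchiMul_eq (k : ℕ) (α a b : F) (X Y : F × F) :
    taniguchiMul (p ^ k) α a b X Y =
      (formP p (k : ZMod m) α a b X Y + formQ p (k : ZMod m) α a b X Y,
        formG p (k : ZMod m) X Y + formH p (k : ZMod m) X Y) := by
  simp only [taniguchiMul, pow_sq_eq_fr (m := m), formP, formQ, formG, formH, fr_natCast]
  refine Prod.ext ?_ ?_ <;> ring

theorem taniguchiMul_smul (k : ℕ) (α a b x u : F) (X Y : F × F) :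
    taniguchiMul (p ^ k) α a b (x • X) (u • Y) =
      (formP p (k : ZMod m) α a b X Y * (fr F p (k : ZMod m) x * fr F p (0 : ZMod m) u)
        + formQ p (k : ZMod m) α a b X Y * (fr F p (0 : ZMod m) x * fr F p (k : ZMod m) u),
       formG p (k : ZMod m) X Y * (fr F p (0 : ZMod m) x * fr F p (2 * (k : ZMod m)) u)
        + formH p (k : ZMod m) X Y * (fr F p (2 * (k : ZMod m)) x * fr F p (0 : ZMod m) u)) := by
  rw [taniguchiMul_eq (m := m)]
  simp only [formP, formQ, formG, formH, fr_zero, Prod.smul_fst, Prod.smul_snd, smul_eq_mul, map_mul]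
  refine Prod.ext ?_ ?_ <;> ring

variable [Algebra (ZMod p) F]

theorem exists_coeff (N : (F × F) →ₗ[ZMod p] (F × F)) : ∃ n₁ n₂ n₃ n₄ : ZMod m → F, ∀ x y,
    N (x, y) = (∑ i, n₁ i * fr F p i x + ∑ i, n₂ i * fr F p i y,
      ∑ i, n₃ i * fr F p i x + ∑ i, n₄ i * fr F p i y) := by
  obtain ⟨n₁, h₁⟩ := exists_fr_coeff (m := m)
    (LinearMap.fst (ZMod p) F F ∘ₗ N ∘ₗ LinearMap.inl (ZMod p) F F)
  obtain ⟨n₂, h₂⟩ := exists_fr_coeff (m := m)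
    (LinearMap.fst (ZMod p) F F ∘ₗ N ∘ₗ LinearMap.inr (ZMod p) F F)
  obtain ⟨n₃, h₃⟩ := exists_fr_coeff (m := m)
    (LinearMap.snd (ZMod p) F F ∘ₗ N ∘ₗ LinearMap.inl (ZMod p) F F)
  obtain ⟨n₄, h₄⟩ := exists_fr_coeff (m := m)
    (LinearMap.snd (ZMod p) F F ∘ₗ N ∘ₗ LinearMap.inr (ZMod p) F F)
  refine ⟨n₁, n₂, n₃, n₄, fun x y => ?_⟩
  rw [← h₁, ← h₂, ← h₃, ← h₄]
  have : (x, y) = ((x, 0) : F × F) + (0, y) := by simp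
  rw [this, map_add]
  rfl

/-- For F-linear `L` and `M`, replacing X, Y by xX, uY turns the isotopism equation into a
polynomial identity in x and u, whose coefficients may be compared. Each monomial composed with N
occupies one diagonal; the right side occupies single positions. -/
theorem coeff_of_isotopism {k₁ k₂ : ℕ} {α a b α' a' b' : F} {N : F × F → F × F}
    {n₁ n₂ n₃ n₄ : ZMod m → F} {L M : (F × F) ≃ₗ[F] (F × F)}
    (hn : ∀ x y, N (x, y) = (∑ i, n₁ i * fr F p i x + ∑ i, n₂ i * fr F p i y,
      ∑ i, n₃ i * fr F p i x + ∑ i, n₄ i * fr F p i y))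
    (hN : ∀ X Y, N (taniguchiMul (p ^ k₁) α a b X Y) = taniguchiMul (p ^ k₂) α' a' b' (L X) (M Y))
    {s₁ s₂ : ZMod m} (hs₁ : s₁ = k₁) (hs₂ : s₂ = k₂) (X Y : F × F) :
    bicomp p n₁ (formP p s₁ α a b X Y) s₁ 0 + bicomp p n₁ (formQ p s₁ α a b X Y) 0 s₁
      + bicomp p n₂ (formG p s₁ X Y) 0 (2 * s₁) + bicomp p n₂ (formH p s₁ X Y) (2 * s₁) 0
      = bimonomial (formP p s₂ α' a' b' (L X) (M Y)) s₂ 0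
        + bimonomial (formQ p s₂ α' a' b' (L X) (M Y)) 0 s₂ ∧
    bicomp p n₃ (formP p s₁ α a b X Y) s₁ 0 + bicomp p n₃ (formQ p s₁ α a b X Y) 0 s₁
      + bicomp p n₄ (formG p s₁ X Y) 0 (2 * s₁) + bicomp p n₄ (formH p s₁ X Y) (2 * s₁) 0
      = bimonomial (formG p s₂ (L X) (M Y)) 0 (2 * s₂)
        + bimonomial (formH p s₂ (L X) (M Y)) (2 * s₂) 0 := by
  subst hs₁ hs₂
  have key : ∀ x u : F, _ := fun x u => hN (x • X) (u • Y)
  simp only [map_smul, taniguchiMul_smul (m := m), hn, map_add, mul_add, Finset.sum_add_distrib,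
    Prod.mk.injEq] at key
  constructor
  · refine bieval_injective (p := p) fun x u => ?_
    simp only [bieval_add, bieval_bimonomial, bieval_bicomp]
    rw [← (key x u).1]; simp only [map_mul]; ring
  · refine bieval_injective (p := p) fun x u => ?_
    simp only [bieval_add, bieval_bimonomial, bieval_bicomp]
    rw [← (key x u).2]; simp only [map_mul]; ring

/-- The form is semilinear in its second argument, so vanishing on the image of a basis means
vanishing identically; it is nondegenerate in the first. -/
theorem eq_zero_of_formQ_eq_zero {s : ZMod m} {α a b : F} (hα : α ≠ 0) (hb : b ≠ 0) {X : F × F}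
    (M : (F × F) ≃ₗ[F] (F × F)) (h₁ : formQ p s α a b X (M (1, 0)) = 0)
    (h₂ : formQ p s α a b X (M (0, 1)) = 0) : X = 0 := by
  have h : ∀ Z, formQ p s α a b X Z = 0 := by
    intro Z
    obtain ⟨⟨x, y⟩, rfl⟩ := M.surjective Z
    have : (x, y) = x • ((1, 0) : F × F) + y • (0, 1) := by simp
    rw [this, map_add, map_smul, map_smul]
    simp only [formQ, Prod.fst_add, Prod.snd_add, Prod.smul_fst, Prod.smul_snd, smul_eq_mul, map_mul,
      map_add] at h₁ h₂ ⊢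
    linear_combination fr F p s x * h₁ + fr F p s y * h₂
  have h₁ := h (1, 0)
  have h₂ := h (0, 1)
  have h3 : X.1 = 0 := by simpa [formQ, hα] using h₁
  have h4 : X.2 = 0 := by simpa [formQ, hα, hb, h3] using h₂
  exact Prod.ext h3 h4

theorem eq_zero_of_formP_eq_zero {s : ZMod m} {α a b : F} (hb : b ≠ 0) {X : F × F}
    (M : (F × F) ≃ₗ[F] (F × F)) (h₁ : formP p s α a b X (M (1, 0)) = 0)
    (h₂ : formP p s α a b X (M (0, 1)) = 0) : X = 0 := by
  have h : ∀ Z, formP p s α a b X Z = 0 := by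
    intro Z
    obtain ⟨⟨x, y⟩, rfl⟩ := M.surjective Z
    have : (x, y) = x • ((1, 0) : F × F) + y • (0, 1) := by simp
    rw [this, map_add, map_smul, map_smul]
    simp only [formP, Prod.fst_add, Prod.snd_add, Prod.smul_fst, Prod.smul_snd, smul_eq_mul] at h₁ h₂ ⊢
    linear_combination x * h₁ + y * h₂
  have h₁ := h (1, 0)
  have h₂ := h (0, 1)
  have h4 : X.2 = 0 := by simpa [formP, hb] using h₂
  have h3 : X.1 = 0 := by simpa [formP, h4] using h₁
  exact Prod.ext h3 h4

/-- The diagonals of the two sides meet too rarely: either N kills (1, 0), or a nondegenerate form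
vanishes at L(1, 0) against every vector. -/
theorem not_isotopism_of_linear {k₁ k₂ : ℕ} {α a b α' a' b' : F} {N : (F × F) ≃ₗ[ZMod p] (F × F)}
    {L M : (F × F) ≃ₗ[F] (F × F)} (hα' : α' ≠ 0) (hb' : b' ≠ 0)
    {s₁ s₂ : ZMod m} (hs₁ : s₁ = k₁) (hs₂ : s₂ = k₂)
    (h2 : 2 * s₁ ≠ 0) (h0 : s₂ ≠ 0) (h12 : s₁ ≠ s₂) (h12' : s₁ ≠ - s₂)
    (hN : ∀ X Y, N (taniguchiMul (p ^ k₁) α a b X Y) = taniguchiMul (p ^ k₂) α' a' b' (L X) (M Y)) :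
    False := by
  obtain ⟨n₁, n₂, n₃, n₄, hn⟩ := exists_coeff (m := m) N.toLinearMap
  have key := coeff_of_isotopism hn hN hs₁ hs₂
  have h1 : s₁ ≠ 0 := by rintro rfl; simp at h2
  have key1 : ∀ X Y i j, _ := fun X Y i j => congrFun (congrFun (key X Y).1 i) j
  have key2 : ∀ X Y i j, _ := fun X Y i j => congrFun (congrFun (key X Y).2 i) j
  clear key
  simp only [Pi.add_apply, bicomp, bimonomial, sub_zero] at key1 key2
  have P11 : formP p s₁ α a b (1, 0) (1, 0) = 1 := by simp [formP]
  have G11 : formG p s₁ ((1, 0) : F × F) (1, 0) = 0 := by simp [formG]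
  have H11 : formH p s₁ ((1, 0) : F × F) (1, 0) = 0 := by simp [formH]
  have H12 : formH p s₁ ((1, 0) : F × F) (0, 1) = 0 := by simp [formH]
  -- On the diagonal of difference s₁ the right side is zero, since its two positions have
  -- differences ±s₂; the hypothesis 2s₁ ≠ 0 keeps the Q-term off this diagonal.
  have hn₁ : ∀ i, n₁ i = 0 := by
    intro i
    have h := key1 (1, 0) (1, 0) (i + s₁) i
    rw [P11, G11, H11, if_pos (by ring),
      if_neg (show ¬ (i + s₁ = i - s₁) from fun h => h2 (by linear_combination h)),
      if_neg (show ¬ (i + s₁ = s₂ ∧ i = 0) from fun h => h12 (by linear_combination h.1 - h.2)),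
      if_neg (show ¬ (i + s₁ = 0 ∧ i = s₂) from fun h => h12' (by linear_combination h.1 - h.2))] at h
    simpa using h
  simp only [hn₁, zero_mul, ite_self, zero_add] at key1
  have hL : L (1, 0) ≠ 0 := by simp
  by_cases h22 : 2 * s₂ = 0
  · have hn₃ : ∀ i, n₃ i = 0 := by
      intro i
      have h := key2 (1, 0) (1, 0) (i + s₁) i
      rw [P11, G11, H11, if_pos (by ring),
        if_neg (show ¬ (i + s₁ = i - s₁) from fun h => h2 (by linear_combination h)),
        if_neg (show ¬ (i + s₁ = 0 ∧ i = 2 * s₂) from fun h =>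
          h1 (by linear_combination h.1 - h.2 - h22)),
        if_neg (show ¬ (i + s₁ = 2 * s₂ ∧ i = 0) from fun h =>
          h1 (by linear_combination h.1 - h.2 + h22))] at h
      simpa using h
    have h10 : N (1, 0) = (0, 0) := by simpa [hn₁, hn₃] using hn 1 0
    have := N.map_eq_zero_iff.mp h10
    simp at this
  · have hP : formP p s₂ α' a' b' (L (1, 0)) (M (1, 0)) = 0 := by
      have h := key1 (1, 0) (1, 0) s₂ 0
      rw [G11, H11, if_pos (show s₂ = s₂ ∧ (0 : ZMod m) = 0 from ⟨rfl, rfl⟩),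
        if_neg (show ¬ (s₂ = 0 ∧ 0 = s₂) from fun h => h0 h.1)] at h
      simpa using h.symm
    have hQ : formQ p s₂ α' a' b' (L (1, 0)) (M (1, 0)) = 0 := by
      have h := key1 (1, 0) (1, 0) 0 s₂
      rw [G11, H11, if_pos (show (0 : ZMod m) = 0 ∧ s₂ = s₂ from ⟨rfl, rfl⟩),
        if_neg (show ¬ (0 = s₂ ∧ s₂ = 0) from fun h => h0 h.2)] at h
      simpa using h.symm
    -- Only the G-term survives for the pair (1, 0), (0, 1). As 2s₂ ≠ 0, its diagonal misses at
    -- least one of the positions (s₂, 0) and (0, s₂), and the form sitting there vanishes.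
    by_cases h3 : s₂ = - (2 * s₁)
    · refine hL (eq_zero_of_formQ_eq_zero hα' hb' M hQ ?_)
      have h := key1 (1, 0) (0, 1) 0 s₂
      rw [H12, if_pos (show (0 : ZMod m) = 0 ∧ s₂ = s₂ from ⟨rfl, rfl⟩),
        if_neg (show ¬ (0 = s₂ ∧ s₂ = 0) from fun h => h0 h.2),
        if_neg (show ¬ (0 = s₂ - 2 * s₁) from fun h => h22 (by linear_combination h3 - h))] at h
      simpa using h.symm
    · refine hL (eq_zero_of_formP_eq_zero hb' M hP ?_)
      have h := key1 (1, 0) (0, 1) s₂ 0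
      rw [H12, if_pos (show s₂ = s₂ ∧ (0 : ZMod m) = 0 from ⟨rfl, rfl⟩),
        if_neg (show ¬ (s₂ = 0 ∧ 0 = s₂) from fun h => h0 h.1),
        if_neg (show ¬ (s₂ = 0 - 2 * s₁) from fun h => h3 (by linear_combination h))] at h
      simpa using h.symm

end Forms

/-! ### Shape of N for equal exponents. -/

section EqualExponents

set_option linter.unusedSectionVars false

variable {F : Type*} [Field F] {p : ℕ} {m : ℕ} [Fact p.Prime] [CharP F p]
  [NeZero m] [Fact (Nat.card F = p ^ m)] [Algebra (ZMod p) F]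

/-- A coefficient of N survives only if it lands on an occupied position of the right side. Beyond
the terms `n` and `g`, this needs a coincidence: 3s = 0 for `ν` and `ω`, and 4s = 0 for `h`. -/
theorem forms_of_isotopism {k : ℕ} {α a b α' a' b' : F} {N : (F × F) →ₗ[ZMod p] (F × F)}
    {L M : (F × F) ≃ₗ[F] (F × F)} {s : ZMod m} (hs : s = k) (h2 : 2 * s ≠ 0)
    (hN : ∀ X Y, N (taniguchiMul (p ^ k) α a b X Y) = taniguchiMul (p ^ k) α' a' b' (L X) (M Y)) :
    ∃ n ν ω g h : F, (3 * s ≠ 0 → ν = 0 ∧ ω = 0) ∧ (4 * s ≠ 0 → h = 0) ∧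
      (∀ x y, N (x, y) = (n * x + ν * fr F p s y,
        ω * fr F p (2 * s) x + (g * y + h * fr F p (2 * s) y))) ∧
      ∀ X Y,
        n * formP p s α a b X Y + ν * fr F p s (formG p s X Y) = formP p s α' a' b' (L X) (M Y) ∧
        n * formQ p s α a b X Y + ν * fr F p s (formH p s X Y) = formQ p s α' a' b' (L X) (M Y) ∧
        ω * fr F p (2 * s) (formP p s α a b X Y) + g * formG p s X Y
          + h * fr F p (2 * s) (formH p s X Y) = formG p s (L X) (M Y) ∧
        ω * fr F p (2 * s) (formQ p s α a b X Y) + g * formH p s X Y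
          + h * fr F p (2 * s) (formG p s X Y) = formH p s (L X) (M Y) := by
  obtain ⟨n₁, n₂, n₃, n₄, hn⟩ := exists_coeff (m := m) N
  have key := coeff_of_isotopism hn hN hs hs
  have h1 : s ≠ 0 := by rintro rfl; simp at h2
  have h1' : ¬ (0 = s) := fun h => h1 h.symm
  have h2' : ¬ (0 = 2 * s) := fun h => h2 h.symm
  have h21 : ¬ (2 * s = s) := fun h => h1 (by linear_combination h)
  have h12 : ¬ (s = 2 * s) := fun h => h1 (by linear_combination -h)
  have key1 : ∀ X Y i j, _ := fun X Y i j => congrFun (congrFun (key X Y).1 i) j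
  have key2 : ∀ X Y i j, _ := fun X Y i j => congrFun (congrFun (key X Y).2 i) j
  clear key
  simp only [Pi.add_apply, bicomp, bimonomial, sub_zero] at key1 key2
  have P11 : formP p s α a b (1, 0) (1, 0) = 1 := by simp [formP]
  have G11 : formG p s ((1, 0) : F × F) (1, 0) = 0 := by simp [formG]
  have H11 : formH p s ((1, 0) : F × F) (1, 0) = 0 := by simp [formH]
  have P12 : formP p s α a b (1, 0) (0, 1) = 0 := by simp [formP]
  have G12 : formG p s ((1, 0) : F × F) (0, 1) = 1 := by simp [formG]
  have H12 : formH p s ((1, 0) : F × F) (0, 1) = 0 := by simp [formH]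
  have hn₁ : ∀ i, i ≠ 0 → n₁ i = 0 := by
    intro i hi
    have h := key1 (1, 0) (1, 0) (i + s) i
    rw [P11, G11, H11, if_pos (by ring),
      if_neg (show ¬ (i + s = i - s) from fun h => h2 (by linear_combination h)),
      if_neg (show ¬ (i + s = s ∧ i = 0) from fun h => hi h.2),
      if_neg (show ¬ (i + s = 0 ∧ i = s) from fun h => h2 (by linear_combination h.1 - h.2))] at h
    simpa using h
  have hn₂' : 3 * s ≠ 0 → ∀ i, n₂ i = 0 := by
    intro h3 i
    have h := key1 (1, 0) (0, 1) i (i + 2 * s)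
    rw [P12, G12, H12, if_pos (show i = i + 2 * s - 2 * s by ring),
      if_neg (show ¬ (i = i + 2 * s - s) from fun h => h1 (by linear_combination -h)),
      if_neg (show ¬ (i = s ∧ i + 2 * s = 0) from fun h => h3 (by linear_combination h.2 - h.1)),
      if_neg (show ¬ (i = 0 ∧ i + 2 * s = s) from fun h => h1 (by linear_combination h.2 - h.1))] at h
    simpa using h
  have hn₂ : ∀ i, i ≠ s → n₂ i = 0 := by
    intro i hi
    by_cases h3 : 3 * s = 0
    · have h := key1 (1, 0) (0, 1) i (i + 2 * s)
      rw [P12, G12, H12, if_pos (show i = i + 2 * s - 2 * s by ring),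
        if_neg (show ¬ (i = i + 2 * s - s) from fun h => h1 (by linear_combination -h)),
        if_neg (show ¬ (i = s ∧ i + 2 * s = 0) from fun h => hi h.1),
        if_neg (show ¬ (i = 0 ∧ i + 2 * s = s) from fun h => h1 (by linear_combination h.2 - h.1))] at h
      simpa using h
    · exact hn₂' h3 i
  have hn₃' : 3 * s ≠ 0 → ∀ i, n₃ i = 0 := by
    intro h3 i
    have h := key2 (1, 0) (1, 0) (i + s) i
    rw [P11, G11, H11, if_pos (by ring),
      if_neg (show ¬ (i + s = i - s) from fun h => h2 (by linear_combination h)),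
      if_neg (show ¬ (i + s = 0 ∧ i = 2 * s) from fun h => h3 (by linear_combination h.1 - h.2)),
      if_neg (show ¬ (i + s = 2 * s ∧ i = 0) from fun h => h1 (by linear_combination h.2 - h.1))] at h
    simpa using h
  have hn₃ : ∀ i, i ≠ 2 * s → n₃ i = 0 := by
    intro i hi
    have h := key2 (1, 0) (1, 0) (i + s) i
    rw [P11, G11, H11, if_pos (by ring),
      if_neg (show ¬ (i + s = i - s) from fun h => h2 (by linear_combination h)),
      if_neg (show ¬ (i + s = 0 ∧ i = 2 * s) from fun h => hi h.2),
      if_neg (show ¬ (i + s = 2 * s ∧ i = 0) from fun h => h1 (by linear_combination h.2 - h.1))] at h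
    simpa using h
  have hn₄' : ∀ i, i ≠ 0 → (i = 2 * s → 4 * s ≠ 0) → n₄ i = 0 := by
    intro i hi h4
    have h := key2 (1, 0) (0, 1) i (i + 2 * s)
    rw [P12, G12, H12, if_pos (show i = i + 2 * s - 2 * s by ring),
      if_neg (show ¬ (i = i + 2 * s - s) from fun h => h1 (by linear_combination -h)),
      if_neg (show ¬ (i = 0 ∧ i + 2 * s = 2 * s) from fun h => hi h.1),
      if_neg (show ¬ (i = 2 * s ∧ i + 2 * s = 0) from
        fun h => h4 h.1 (by linear_combination h.2 - h.1))] at h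
    simpa using h
  have hn₄ : ∀ i, i ≠ 0 → i ≠ 2 * s → n₄ i = 0 := fun i hi hi' => hn₄' i hi fun h => absurd h hi'
  refine ⟨n₁ 0, n₂ s, n₃ (2 * s), n₄ 0, n₄ (2 * s), fun h3 => ⟨hn₂' h3 s, hn₃' h3 (2 * s)⟩,
    fun h4 => hn₄' (2 * s) h2 fun _ => h4, ?_, ?_⟩
  · intro x y
    rw [hn]
    have e1 : ∑ i, n₁ i * fr F p i x = n₁ 0 * x := by
      rw [Finset.sum_eq_single 0 (fun i _ hi => by rw [hn₁ i hi, zero_mul]) (by simp), fr_zero]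
    have e2 : ∑ i, n₂ i * fr F p i y = n₂ s * fr F p s y :=
      Finset.sum_eq_single s (fun i _ hi => by rw [hn₂ i hi, zero_mul]) (by simp)
    have e3 : ∑ i, n₃ i * fr F p i x = n₃ (2 * s) * fr F p (2 * s) x :=
      Finset.sum_eq_single (2 * s) (fun i _ hi => by rw [hn₃ i hi, zero_mul]) (by simp)
    have e4 : ∑ i, n₄ i * fr F p i y = n₄ 0 * y + n₄ (2 * s) * fr F p (2 * s) y := by
      rw [Finset.sum_eq_add 0 (2 * s) h2' (fun i _ hi => by rw [hn₄ i hi.1 hi.2, zero_mul])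
        (by simp) (by simp), fr_zero]
    rw [e1, e2, e3, e4]
  · intro X Y
    have hs' : ∀ i j : ZMod m, i = j → fr F p i = fr F p j := fun i j h => by rw [h]
    refine ⟨?_, ?_, ?_, ?_⟩
    · have h := key1 X Y s 0
      rw [if_pos (show s - s = 0 by ring), if_neg (show ¬ (s = 0 - s) from
          fun h => h2 (by linear_combination h)),
        if_neg (show ¬ (s - 2 * s = 0) from fun h => h1 (by linear_combination -h)),
        if_pos (show s = s ∧ (0 : ZMod m) = 0 from ⟨rfl, rfl⟩),
        if_neg (show ¬ (s = 0 ∧ 0 = s) from fun h => h1 h.1), sub_self, fr_zero] at h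
      by_cases h3 : s = 0 - 2 * s
      · rw [if_pos h3] at h; linear_combination h
      · rw [if_neg h3] at h
        rw [hn₂' fun h => h3 (by linear_combination h)]; linear_combination h
    · have h := key1 X Y 0 s
      rw [if_neg (show ¬ (0 - s = s) from fun h => h2 (by linear_combination -h)),
        if_pos (show 0 = s - s by ring),
        if_neg (show ¬ (0 = s - 2 * s) from fun h => h1 (by linear_combination h)),
        if_pos (show (0 : ZMod m) = 0 ∧ s = s from ⟨rfl, rfl⟩),
        if_neg (show ¬ (0 = s ∧ s = 0) from fun h => h1 h.2), fr_zero] at h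
      by_cases h3 : 0 - 2 * s = s
      · rw [if_pos h3, h3] at h; linear_combination h
      · rw [if_neg h3] at h
        rw [hn₂' fun h => h3 (by linear_combination -h)]; linear_combination h
    · have h := key2 X Y 0 (2 * s)
      rw [if_neg (show ¬ (0 = 2 * s - s) from fun h => h1 (by linear_combination -h)),
        if_pos (show 0 = 2 * s - 2 * s by ring),
        if_pos (show (0 : ZMod m) = 0 ∧ 2 * s = 2 * s from ⟨rfl, rfl⟩),
        if_neg (show ¬ (0 = 2 * s ∧ 2 * s = 0) from fun h => h2 h.2), fr_zero] at h
      have e3 : (if 0 - s = 2 * s then n₃ (0 - s) * fr F p (0 - s) (formP p s α a b X Y) else 0)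
          = n₃ (2 * s) * fr F p (2 * s) (formP p s α a b X Y) := by
        split_ifs with h3
        · rw [h3]
        · rw [hn₃' fun h => h3 (by linear_combination -h), zero_mul]
      have e4 : (if 0 - 2 * s = 2 * s then
          n₄ (0 - 2 * s) * fr F p (0 - 2 * s) (formH p s X Y) else 0)
          = n₄ (2 * s) * fr F p (2 * s) (formH p s X Y) := by
        split_ifs with h4
        · rw [h4]
        · rw [hn₄' (2 * s) h2 fun _ h => h4 (by linear_combination -h), zero_mul]
      rw [e3, e4] at h
      linear_combination h
    · have h := key2 X Y (2 * s) 0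
      rw [if_neg (show ¬ (2 * s - s = 0) from fun h => h1 (by linear_combination h)),
        if_pos (show 2 * s - 2 * s = 0 by ring),
        if_pos (show 2 * s = 2 * s ∧ (0 : ZMod m) = 0 from ⟨rfl, rfl⟩),
        if_neg (show ¬ (2 * s = 0 ∧ 0 = 2 * s) from fun h => h2 h.1), sub_self, fr_zero] at h
      have e3 : (if 2 * s = 0 - s then n₃ (2 * s) * fr F p (2 * s) (formQ p s α a b X Y) else 0)
          = n₃ (2 * s) * fr F p (2 * s) (formQ p s α a b X Y) := by
        split_ifs with h3
        · rfl
        · rw [hn₃' fun h => h3 (by linear_combination h), zero_mul]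
      have e4 : (if 2 * s = 0 - 2 * s then n₄ (2 * s) * fr F p (2 * s) (formG p s X Y) else 0)
          = n₄ (2 * s) * fr F p (2 * s) (formG p s X Y) := by
        split_ifs with h4
        · rfl
        · rw [hn₄' (2 * s) h2 fun _ h => h4 (by linear_combination h), zero_mul]
      rw [e3, e4] at h
      linear_combination h

/-- A consequence of Hilbert's theorem 90 for an automorphism of order three. -/
theorem exists_fr_eq_of_norm_eq_one {s : ZMod m} (h1 : s ≠ 0) (h3 : 3 * s = 0) {c : F}
    (hc : c * fr F p s c * fr F p (2 * s) c = 1) : ∃ z : F, z ≠ 0 ∧ fr F p s z = c * z := by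
  have hc0 : c ≠ 0 := by rintro rfl; simp at hc
  have h2 : 2 * s ≠ 0 := fun h => h1 (by linear_combination h3 - h)
  have h21 : 2 * s ≠ s := fun h => h1 (by linear_combination h)
  -- A nonzero value of this resolvent is the required z; it cannot vanish identically because 1, σ,
  -- σ² are independent.
  by_cases h : ∀ θ : F, θ + fr F p s c * fr F p (2 * s) c * fr F p s θ
      + fr F p (2 * s) c * fr F p (2 * s) θ = 0
  · have := eq_zero_of_sum_fr (p := p) (fun i : ZMod m => if i = 0 then (1 : F) else if i = s then
      fr F p s c * fr F p (2 * s) c else if i = 2 * s then fr F p (2 * s) c else 0) (fun θ => by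
        refine Eq.trans ?_ (h θ)
        rw [← Finset.sum_subset (Finset.subset_univ {0, s, 2 * s})
          (fun i _ hi => by simp at hi; simp [hi]), Finset.sum_insert (by simp [h1.symm, h2.symm]),
          Finset.sum_pair h21.symm]
        simp [h1, h2, h21, fr_zero]; ring) 0
    simp at this
  · push Not at h
    obtain ⟨θ, hθ⟩ := h
    have e : ∀ x : F, fr F p s (fr F p (2 * s) x) = x := fun x => by
      rw [← fr_add, show s + 2 * s = 0 by linear_combination h3, fr_zero]
    have e' : ∀ x : F, fr F p s (fr F p s x) = fr F p (2 * s) x := fun x => (fr_two_mul s x).symm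
    refine ⟨_, hθ, ?_⟩
    simp only [map_add, map_mul, e, e']
    linear_combination (-fr F p s θ) * hc

end EqualExponents

/-! ### Diagonal and antidiagonal isotopisms and the resulting parameter relation. -/

section Classification

set_option linter.unusedSectionVars false

variable {F : Type*} [Field F] {p : ℕ} {m : ℕ} [Fact p.Prime] [CharP F p]
  [NeZero m] [Fact (Nat.card F = p ^ m)] [Algebra (ZMod p) F]

/-- Each form on the right is a product of a function of X and a function of Y, so its 2 × 2 matrix
of values has determinant zero. If ω ≠ 0, the two determinants together give -α norm 1 under σ of
order three, and Hilbert 90 contradicts the hypothesis on α. -/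
theorem coeff_eq_zero_of_norm {s : ZMod m} {α a b ω g : F} (h1 : s ≠ 0) (h3 : 3 * s = 0)
    (hα : ∀ z : F, z ≠ 0 → fr F p s z ≠ -α * z) (hb : b ≠ 0)
    {X₁ X₂ Y₁ Y₂ : F × F}
    (hG : ∀ i j : Bool, ω * fr F p (2 * s) (formP p s α a b (cond i (1, 0) (0, 1))
        (cond j (1, 0) (0, 1))) + g * formG p s (cond i (1, 0) (0, 1)) (cond j (1, 0) (0, 1))
        = formG p s (cond i X₁ X₂) (cond j Y₁ Y₂))
    (hH : ∀ i j : Bool, ω * fr F p (2 * s) (formQ p s α a b (cond i (1, 0) (0, 1))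
        (cond j (1, 0) (0, 1))) + g * formH p s (cond i (1, 0) (0, 1)) (cond j (1, 0) (0, 1))
        = formH p s (cond i X₁ X₂) (cond j Y₁ Y₂)) : ω = 0 := by
  by_contra hω
  have G11 := hG true true
  have G12 := hG true false
  have G21 := hG false true
  have G22 := hG false false
  have H11 := hH true true
  have H12 := hH true false
  have H21 := hH false true
  have H22 := hH false false
  have e : ∀ x : F, fr F p (2 * s) (fr F p s x) = x := fun x => by
    rw [← fr_add, show 2 * s + s = 0 by linear_combination h3, fr_zero]
  have e' : ∀ x : F, fr F p (2 * s) (fr F p (2 * s) x) = fr F p s x := fun x => by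
    rw [← fr_add, show 2 * s + 2 * s = s by linear_combination h3]
  simp only [formP, formQ, formG, formH, cond_true, cond_false, map_zero, map_one, map_mul,
    mul_zero, mul_one, add_zero, zero_add, sub_zero, zero_sub, map_neg, e, e']
    at G11 G12 G21 G22 H11 H12 H21 H22
  set a₂ := fr F p (2 * s) a
  set b₂ := fr F p (2 * s) b
  set α₁ := fr F p s α
  set α₂ := fr F p (2 * s) α
  have hb₂ : b₂ ≠ 0 := by simpa [b₂] using hb
  have d1 : ω * (ω * b₂ + g * (a₂ * α)) = 0 := by
    have : (ω * 1) * (ω * -b₂) = g * (ω * (a₂ * α)) := by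
      rw [G12, G22, G21, mul_one, G11]; ring
    linear_combination -this
  have d2 : ω * (ω * (α₁ * b₂ * α₂) - g * a₂) = 0 := by
    have : (ω * α₁) * (ω * -(b₂ * α₂)) = (ω * -a₂) * g := by
      rw [H12, H22, H21, H11]; ring
    linear_combination -this
  have d1' := (mul_eq_zero.mp d1).resolve_left hω
  have d2' := (mul_eq_zero.mp d2).resolve_left hω
  have d3 : ω * b₂ * (1 + α * α₁ * α₂) = 0 := by
    linear_combination d1' + α * d2'
  have d4 := (mul_eq_zero.mp d3).resolve_left (mul_ne_zero hω hb₂)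
  obtain ⟨z, hz, hz'⟩ := exists_fr_eq_of_norm_eq_one (p := p) (c := -α) h1 h3 (by
    simp only [map_neg]; linear_combination -d4)
  exact hα z hz hz'

/-- The conditions for diagonal maps with entries `A`, `D` and `A'`, `D'` to form an isotopism. -/
def DiagRel (p : ℕ) [Fact p.Prime] [CharP F p] (s : ZMod m) (α a b α' a' b' A D A' D' : F) : Prop :=
  ∃ n : F, fr F p s A * A' = n ∧ fr F p (2 * s) α' * A * fr F p s A' = n * fr F p (2 * s) α ∧
    a' * A * fr F p s D' = n * a ∧ b' * fr F p s D * D' = n * b ∧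
    A * fr F p (2 * s) D' = fr F p (2 * s) D * A'

/-- The conditions for antidiagonal maps with entries `B`, `C` and `B'`, `C'` to form an
isotopism. -/
def AntidiagRel (p : ℕ) [Fact p.Prime] [CharP F p] (s : ZMod m) (α a b α' a' b' B C B' C' : F) :
    Prop :=
  4 * s = 0 ∧ a = 0 ∧ a' = 0 ∧ ∃ n : F, -(b' * fr F p s C * C') = n ∧
    -(b' * α' * C * fr F p s C') = n * fr F p (2 * s) α ∧
    fr F p s B * B' = -(n * b) ∧ B * fr F p (2 * s) C' = fr F p (2 * s) C * B'

/-- Once `ω` is gone, the rank-one forms G and H force exactly one of `g`, `h` to vanish, and the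
zero entries in their value tables make half the entries of L and M zero. -/
theorem diag_or_antidiag {k : ℕ} {α a b α' a' b' : F} {N : (F × F) ≃ₗ[ZMod p] (F × F)}
    {L M : (F × F) ≃ₗ[F] (F × F)} {s : ZMod m} (hs : s = k) (h2 : 2 * s ≠ 0)
    (hα : ∀ z : F, z ≠ 0 → fr F p s z ≠ -α * z) (hα' : α' ≠ 0) (hb : b ≠ 0)
    (hN : ∀ X Y, N (taniguchiMul (p ^ k) α a b X Y) = taniguchiMul (p ^ k) α' a' b' (L X) (M Y)) :
    (∃ A D A' D' : F, A ≠ 0 ∧ D ≠ 0 ∧ A' ≠ 0 ∧ D' ≠ 0 ∧ (∀ x y, L (x, y) = (A * x, D * y)) ∧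
      (∀ x y, M (x, y) = (A' * x, D' * y)) ∧ DiagRel p s α a b α' a' b' A D A' D') ∨
    (∃ B C B' C' : F, B ≠ 0 ∧ C ≠ 0 ∧ B' ≠ 0 ∧ C' ≠ 0 ∧ (∀ x y, L (x, y) = (B * y, C * x)) ∧
      (∀ x y, M (x, y) = (B' * y, C' * x)) ∧ AntidiagRel p s α a b α' a' b' B C B' C') := by
  obtain ⟨n, ν, ω, g, h, hνω, hh, hNe, key⟩ :=
    forms_of_isotopism (N := N.toLinearMap) hs h2 hN
  have h1 : s ≠ 0 := by rintro rfl; simp at h2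
  have hω : ω = 0 := by
    by_cases h3 : 3 * s = 0
    · have h0 : h = 0 := hh fun h4 => h1 (by linear_combination h4 - h3)
      refine coeff_eq_zero_of_norm (X₁ := L (1, 0)) (X₂ := L (0, 1)) (Y₁ := M (1, 0))
        (Y₂ := M (0, 1)) (g := g) (a := a) h1 h3 hα hb (fun i j => ?_) (fun i j => ?_)
      · have := (key (cond i (1, 0) (0, 1)) (cond j (1, 0) (0, 1))).2.2.1
        rw [h0, zero_mul, add_zero] at this
        rw [this]; cases i <;> cases j <;> rfl
      · have := (key (cond i (1, 0) (0, 1)) (cond j (1, 0) (0, 1))).2.2.2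
        rw [h0, zero_mul, add_zero] at this
        rw [this]; cases i <;> cases j <;> rfl
    · exact (hνω h3).2
  subst hω
  have hn : n ≠ 0 := by
    rintro rfl
    have h10 : N (1, 0) = (0, 0) := (hNe 1 0).trans (by simp)
    have := N.map_eq_zero_iff.mp h10
    simp at this
  have hgh : ¬ (g = 0 ∧ h = 0) := by
    rintro ⟨rfl, rfl⟩
    obtain ⟨⟨x, y⟩, hxy⟩ := N.surjective (0, 1)
    have := hNe x y
    rw [LinearEquiv.coe_coe, hxy] at this
    simp at this
  have key11 := key (1, 0) (1, 0)
  have key12 := key (1, 0) (0, 1)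
  have key21 := key (0, 1) (1, 0)
  have key22 := key (0, 1) (0, 1)
  have hLe : ∀ x y, L (x, y) = x • L (1, 0) + y • L (0, 1) := fun x y => by
    rw [← map_smul, ← map_smul, ← map_add]; simp
  have hMe : ∀ x y, M (x, y) = x • M (1, 0) + y • M (0, 1) := fun x y => by
    rw [← map_smul, ← map_smul, ← map_add]; simp
  rcases hL1 : L (1, 0) with ⟨A, C⟩
  rcases hL2 : L (0, 1) with ⟨B, D⟩
  rcases hM1 : M (1, 0) with ⟨A', C'⟩
  rcases hM2 : M (0, 1) with ⟨B', D'⟩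
  simp only [hL1, hL2, hM1, hM2, Prod.smul_mk, smul_eq_mul, Prod.mk_add_mk] at key11 key12 key21 key22 hLe hMe
  simp only [formP, formQ, formG, formH, map_zero, map_one, map_mul, map_neg,
    mul_zero, mul_one, zero_mul, add_zero, zero_add, sub_zero, zero_sub] at key11 key12 key21 key22
  obtain ⟨P11, Q11, G11, H11⟩ := key11
  obtain ⟨P12, Q12, G12, H12⟩ := key12
  obtain ⟨P21, Q21, G21, H21⟩ := key21
  obtain ⟨P22, Q22, G22, H22⟩ := key22
  -- The determinant of the value table of G vanishes, and so does its entry at (1, 0), (1, 0).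
  have hgh' : g * h = 0 := by
    have : g * h = (A * fr F p (2 * s) D') * (B * fr F p (2 * s) C') := by rw [← G12, ← G21]
    rw [this]
    linear_combination (-B * fr F p (2 * s) D') * G11
  rcases mul_eq_zero.mp hgh' with hg | hh0
  · right
    have hh0 : h ≠ 0 := fun h0 => hgh ⟨hg, h0⟩
    have h4 : 4 * s = 0 := by by_contra h4; exact hh0 (hh h4)
    obtain ⟨hν, -⟩ := hνω fun h3 => h1 (by linear_combination h4 - h3)
    subst hg hν
    have hB : B ≠ 0 := by rintro rfl; simp [hh0] at G21
    have hC' : C' ≠ 0 := by rintro rfl; simp [hh0] at G21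
    have hC : C ≠ 0 := by rintro rfl; simp [hh0] at H12
    have hB' : B' ≠ 0 := by rintro rfl; simp [hh0] at H12
    have hA : A = 0 := by simpa [hC'] using G11
    have hD' : D' = 0 := by simpa [hB] using G22
    have hA' : A' = 0 := by simpa [hC] using H11
    have hD : D = 0 := by simpa [hB'] using H22
    subst hA hD' hA' hD
    simp only [map_zero, mul_zero, zero_mul, add_zero, zero_add, sub_zero, zero_sub] at *
    have ha : a = 0 := by simpa [hn] using Q12
    refine ⟨B, C, B', C', hB, hC, hB', hC', fun x y => by rw [hLe, mul_comm x, mul_comm y],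
      fun x y => by rw [hMe, mul_comm x, mul_comm y], h4, ha, ?_, n, P11.symm, Q11.symm, ?_,
      ?_⟩
    · simpa [hα', hC, hB'] using P12.symm
    · rw [← P22]; ring
    · rw [← G21, ← H12]
  · left
    have hg : g ≠ 0 := fun h0 => hgh ⟨h0, hh0⟩
    subst hh0
    have hA : A ≠ 0 := by rintro rfl; simp [hg] at G12
    have hD' : D' ≠ 0 := by rintro rfl; simp [hg] at G12
    have hD : D ≠ 0 := by rintro rfl; simp [hg] at H21
    have hA' : A' ≠ 0 := by rintro rfl; simp [hg] at H21
    have hC' : C' = 0 := by simpa [hA] using G11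
    have hB : B = 0 := by simpa [hD'] using G22
    have hC : C = 0 := by simpa [hA'] using H11
    have hB' : B' = 0 := by simpa [hD] using H22
    subst hC' hB hC hB'
    simp only [map_zero, mul_zero, zero_mul, add_zero, zero_add, sub_zero, zero_sub] at *
    refine ⟨A, D, A', D', hA, hD, hA', hD', fun x y => by rw [hLe, mul_comm x, mul_comm y],
      fun x y => by rw [hMe, mul_comm x, mul_comm y], n, ?_, ?_, ?_, ?_, ?_⟩
    · rw [← P11]
    · rw [← Q11]
    · linear_combination Q12
    · linear_combination P22
    · rw [← G12, ← H21]

/-- Everything is expressed through t = D'/D: the equality of the two G/H coefficients gives A' = A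
σ²(t), and the remaining relations simplify. -/
theorem exists_of_diagRel {s : ZMod m} {α a b α' a' b' A D A' D' : F} (hA : A ≠ 0) (hD : D ≠ 0)
    (hA' : A' ≠ 0) (hD' : D' ≠ 0) (h : DiagRel p s α a b α' a' b' A D A' D') :
    ∃ t : F, t ≠ 0 ∧ D' = D * t ∧ A' = A * fr F p s (fr F p s t) ∧ α' * fr F p s t = α * t ∧
      a' * fr F p s (D * t) = fr F p s (A * fr F p s t) * a ∧
      b' * fr F p s D * D * t = b * fr F p s A * A * fr F p s (fr F p s t) := by
  obtain ⟨n, hn, h1, h2, h3, h4⟩ := h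
  obtain ⟨t, rfl⟩ : ∃ t, D' = D * t := ⟨D' / D, by field_simp⟩
  have ht : t ≠ 0 := right_ne_zero_of_mul hD'
  have hA'' : A' = A * fr F p (2 * s) t := by
    have h0 : fr F p (2 * s) D ≠ 0 := by simpa using hD
    rw [map_mul] at h4
    exact mul_left_cancel₀ h0 (by linear_combination -h4)
  have hσA : fr F p s A ≠ 0 := by simpa using hA
  have e := fr_two_mul (p := p) s t
  subst hA'' hn
  refine ⟨t, ht, rfl, by rw [e], ?_, ?_, ?_⟩
  · apply (fr F p (2 * s)).injective
    have e' : fr F p (2 * s) (fr F p s t) = fr F p s (fr F p (2 * s) t) := by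
      rw [← fr_add, ← fr_add, add_comm]
    rw [map_mul, map_mul] at *
    rw [e']
    refine mul_left_cancel₀ (mul_ne_zero hA hσA) ?_
    linear_combination h1
  · refine mul_left_cancel₀ hA ?_
    rw [e] at h2
    simp only [map_mul] at h2 ⊢
    linear_combination h2
  · rw [e] at h3
    linear_combination h3

/-- An antidiagonal isotopism gives the same kind of relation as a diagonal one, but with the
parameters twisted by σ³ = σ⁻¹. -/
theorem exists_of_antidiagRel {s : ZMod m} {α a b α' a' b' B C B' C' : F} (hα : α ≠ 0) (hb : b ≠ 0)
    (hb' : b' ≠ 0) (hB : B ≠ 0) (hC : C ≠ 0) (hC' : C' ≠ 0)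
    (h : AntidiagRel p s α a b α' a' b' B C B' C') :
    ∃ t : F, t ≠ 0 ∧ α' * fr F p s t = fr F p (3 * s) α * t ∧
      ∃ w : F, w ≠ 0 ∧ b' = fr F p (3 * s) b * (fr F p s w * w) := by
  obtain ⟨h4, -, -, n, hn, h1, h2, h3⟩ := h
  obtain ⟨u, rfl⟩ : ∃ u, C' = C * u := ⟨C' / C, by field_simp⟩
  have hu : u ≠ 0 := right_ne_zero_of_mul hC'
  have hσC : fr F p s C ≠ 0 := by simpa using hC
  have hB' : B' = B * fr F p (2 * s) u := by
    have h0 : fr F p (2 * s) C ≠ 0 := by simpa using hC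
    rw [map_mul] at h3
    exact mul_left_cancel₀ h0 (by linear_combination -h3)
  have e := fr_two_mul (p := p) s u
  have e3 : ∀ x : F, fr F p (3 * s) x = fr F p s (fr F p (2 * s) x) := fun x => by
    rw [← fr_add]; congr 2; ring
  have e4 : ∀ x : F, fr F p s (fr F p (3 * s) x) = x := fun x => by
    rw [← fr_add, show s + 3 * s = 0 by linear_combination h4, fr_zero]
  subst hB' hn
  set β := fr F p (2 * s) α with hβ
  have hβ0 : β ≠ 0 := by simpa [β] using hα
  have hαβ : β * u = α' * fr F p s u := by
    refine mul_left_cancel₀ (mul_ne_zero (mul_ne_zero hb' hC) hσC) ?_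
    rw [map_mul] at h1
    linear_combination h1
  refine ⟨u * β, mul_ne_zero hu hβ0, ?_, ?_⟩
  · rw [e3, map_mul]
    linear_combination (-fr F p s β) * hαβ
  · have hc : fr F p (3 * s) b ≠ 0 := by simpa using hb
    have hσu : fr F p s u ≠ 0 := by simpa using hu
    -- Dividing by σ³(b) trades b for its twist, since σ(σ³(b)) = b.
    refine ⟨B / C * (fr F p s u / u) / fr F p (3 * s) b, by simp [hB, hC, hu, hb], ?_⟩
    simp only [map_mul, map_div₀, e4]
    rw [e] at h2
    field_simp
    linear_combination -h2

/-- The relation between the parameters of isotopic Taniguchi pre-semifields with the same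
exponent. -/
def ParamRel (p : ℕ) [Fact p.Prime] [CharP F p] (s : ZMod m) (α a b α' a' b' : F) : Prop :=
  ∃ i : ZMod m, (∃ t : F, t ≠ 0 ∧ α' * fr F p s t = fr F p i α * t) ∧
    ((a = 0 ∧ a' = 0 ∧ ∃ w : F, w ≠ 0 ∧ b' = fr F p i b * (fr F p s w * w)) ∨
      (a = 1 ∧ a' = 1 ∧ b' = fr F p i b))

theorem paramRel_of_linear_isotopism {k : ℕ} {α a b α' a' b' : F} {N : (F × F) ≃ₗ[ZMod p] (F × F)}
    {L M : (F × F) ≃ₗ[F] (F × F)} {s : ZMod m} (hs : s = k) (h2 : 2 * s ≠ 0)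
    (hα : ∀ z : F, z ≠ 0 → fr F p s z ≠ -α * z) (hα0 : α ≠ 0) (hα' : α' ≠ 0) (hb : b ≠ 0)
    (hb' : b' ≠ 0) (ha : a = 0 ∨ a = 1) (ha' : a' = 0 ∨ a' = 1)
    (hN : ∀ X Y, N (taniguchiMul (p ^ k) α a b X Y) = taniguchiMul (p ^ k) α' a' b' (L X) (M Y)) :
    ParamRel p s α a b α' a' b' := by
  rcases diag_or_antidiag hs h2 hα hα' hb hN with
    ⟨A, D, A', D', hA, hD, hA', hD', -, -, h⟩ | ⟨B, C, B', C', hB, hC, hB', hC', -, -, h⟩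
  · obtain ⟨t, ht, -, -, h1, h2, h3⟩ := exists_of_diagRel hA hD hA' hD' h
    refine ⟨0, ⟨t, ht, by rw [fr_zero, h1]⟩, ?_⟩
    have hσt : fr F p s t ≠ 0 := by simpa using ht
    have hσσt : fr F p s (fr F p s t) ≠ 0 := by simpa using ht
    have hσD : fr F p s D ≠ 0 := by simpa using hD
    have hσA : fr F p s A ≠ 0 := by simpa using hA
    rcases ha with rfl | rfl
    · have ha' : a' = 0 := by simpa [hD, ht] using h2
      refine Or.inl ⟨rfl, ha', A / D * (fr F p s t / t), by simp [hA, hD, ht], ?_⟩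
      simp only [map_mul, map_div₀, fr_zero]
      field_simp
      linear_combination h3
    -- For a = a' = 1 the a-relation determines D from A and t, and then b' = b exactly instead of
    -- up to a (q+1)-st power.
    · rcases ha' with rfl | rfl
      · simp [hA, ht] at h2
      · refine Or.inr ⟨rfl, rfl, ?_⟩
        rw [one_mul, mul_one] at h2
        have h4 := (fr F p s).injective h2
        have h5 : D = A * fr F p s t / t := by field_simp; exact h4
        rw [h5] at h3
        simp only [map_mul, map_div₀] at h3
        rw [fr_zero]
        field_simp at h3
        exact h3
  · obtain ⟨t, ht, h1, w, hw, h2⟩ := exists_of_antidiagRel hα0 hb hb' hB hC hC' h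
    exact ⟨3 * s, ⟨t, ht, h1⟩, Or.inl ⟨h.2.1, h.2.2.1, w, hw, h2⟩⟩

end Classification

/-! ### Primitive prime divisors through cyclotomic values. -/

section PrimitivePrimeDivisors

open Polynomial

theorem orderOf_eq_of_dvd_cyclotomic {a m ℓ : ℕ} (hℓ : ℓ.Prime) (hm : ¬ ℓ ∣ m)
    (h : (ℓ : ℤ) ∣ (cyclotomic m ℤ).eval (a : ℤ)) : orderOf (a : ZMod ℓ) = m := by
  have := Fact.mk hℓ
  have h0 : NeZero (m : ZMod ℓ) := ⟨fun h => hm ((ZMod.natCast_eq_zero_iff m ℓ).mp h)⟩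
  have h1 : (cyclotomic m (ZMod ℓ)).IsRoot (a : ZMod ℓ) := by
    rw [IsRoot.def, ← map_cyclotomic_int, eval_natCast_map]
    exact (ZMod.intCast_zmod_eq_zero_iff_dvd _ _).mpr h
  exact (isRoot_cyclotomic_iff.mp h1).eq_orderOf.symm

theorem orderOf_eq_of_dvd_cyclotomic_of_pow_mul {a i w ℓ : ℕ} (hℓ : ℓ.Prime) (hw : ¬ ℓ ∣ w)
    (h : (ℓ : ℤ) ∣ (cyclotomic (ℓ ^ i * w) ℤ).eval (a : ℤ)) : orderOf (a : ZMod ℓ) = w := by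
  have := Fact.mk hℓ
  have h0 : NeZero (w : ZMod ℓ) := ⟨fun h => hw ((ZMod.natCast_eq_zero_iff w ℓ).mp h)⟩
  have h1 : (cyclotomic (ℓ ^ i * w) (ZMod ℓ)).IsRoot (a : ZMod ℓ) := by
    rw [IsRoot.def, ← map_cyclotomic_int, eval_natCast_map]
    exact (ZMod.intCast_zmod_eq_zero_iff_dvd _ _).mpr h
  exact (isRoot_cyclotomic_prime_pow_mul_iff_of_charP.mp h1).eq_orderOf.symm

theorem orderOf_natCast_dvd_sub_one {a ℓ : ℕ} (hℓ : ℓ.Prime) (h0 : orderOf (a : ZMod ℓ) ≠ 0) :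
    orderOf (a : ZMod ℓ) ∣ ℓ - 1 := by
  have := Fact.mk hℓ
  refine ZMod.orderOf_dvd_card_sub_one fun ha => h0 ?_
  rw [ha, orderOf_eq_zero_iff]
  intro h
  rw [isOfFinOrder_iff_pow_eq_one] at h
  obtain ⟨n, hn, h⟩ := h
  rw [zero_pow (by omega)] at h
  exact zero_ne_one h

/-- With m = dℓ and c = a^d ≡ 1 mod ℓ, the value divides 1 + c + ... + c^(ℓ-1), which is ≡ ℓ mod ℓ²
for odd ℓ. -/
theorem not_sq_dvd_cyclotomic_eval {a m ℓ : ℕ} (ha : 1 < a) (hm : 3 ≤ m) (hℓ : ℓ.Prime)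
    (hdvd : ℓ ∣ m) (h : (ℓ : ℤ) ∣ (cyclotomic m ℤ).eval (a : ℤ)) :
    ¬ (ℓ : ℤ) ^ 2 ∣ (cyclotomic m ℤ).eval (a : ℤ) := by
  have := Fact.mk hℓ
  obtain ⟨i, w, hw, rfl⟩ := Nat.exists_eq_pow_mul_and_not_dvd (n := m) (by omega) ℓ hℓ.ne_one
  have hi : i ≠ 0 := by rintro rfl; simp [hw] at hdvd
  obtain ⟨i, rfl⟩ := Nat.exists_eq_succ_of_ne_zero hi
  have hord := orderOf_eq_of_dvd_cyclotomic_of_pow_mul hℓ hw h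
  set d := ℓ ^ i * w with hd
  have hd0 : 0 < d := Nat.pos_of_ne_zero (by rintro h0; rw [pow_succ, mul_right_comm, ← hd, h0] at hm; omega)
  have hmd : ℓ ^ (i + 1) * w = d * ℓ := by rw [hd]; ring
  rw [Nat.succ_eq_add_one, hmd] at *
  have h1 : ((a : ℤ) ^ d - 1) * (cyclotomic (d * ℓ) ℤ).eval (a : ℤ) ∣ (a : ℤ) ^ (d * ℓ) - 1 := by
    have := map_dvd (evalRingHom (a : ℤ)) (X_pow_sub_one_mul_cyclotomic_dvd_X_pow_sub_one_of_dvd ℤ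
      (d := d) (n := d * ℓ) (Nat.mem_properDivisors.mpr ⟨Dvd.intro _ rfl, by
        have := hℓ.two_le; nlinarith⟩))
    simpa using this
  set c : ℤ := (a : ℤ) ^ d with hc
  have hc1 : c - 1 ≠ 0 := by
    have : (1 : ℤ) < (a : ℤ) ^ d := one_lt_pow₀ (by exact_mod_cast ha) hd0.ne'
    rw [hc]; omega
  have h2 : (cyclotomic (d * ℓ) ℤ).eval (a : ℤ) ∣ ∑ j ∈ Finset.range ℓ, c ^ j := by
    rw [pow_mul, ← hc, ← mul_geom_sum c ℓ] at h1
    exact Int.dvd_of_mul_dvd_mul_left hc1 h1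
  have h3 : (ℓ : ℤ) ∣ c - 1 := by
    rw [← ZMod.intCast_zmod_eq_zero_iff_dvd]
    push_cast
    rw [hc, Int.cast_pow, Int.cast_natCast, orderOf_dvd_iff_pow_eq_one.mp, sub_self]
    rw [hord, hd]; exact Dvd.intro_left _ rfl
  obtain ⟨e, he⟩ := h3
  intro hsq
  have hsq2 := hsq.trans h2
  rcases hℓ.eq_two_or_odd' with rfl | hodd
  -- For ℓ = 2, m is a power of two and at least 4, so c is an odd square and 1 + c ≡ 2 mod 4.
  · have hw1 : w ∣ 2 - 1 := by
      have := orderOf_natCast_dvd_sub_one (a := a) hℓ (by rw [hord]; rintro rfl; simp at hw)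
      rwa [hord] at this
    have hw1 : w = 1 := by simpa using hw1
    have hi : i ≠ 0 := by rintro rfl; simp [hw1] at hm
    obtain ⟨i, rfl⟩ := Nat.exists_eq_succ_of_ne_zero hi
    have hcs : c = ((a : ℤ) ^ 2 ^ i) ^ 2 := by
      rw [hc, hd, hw1, ← pow_mul]; congr 1; rw [pow_succ]; ring
    have hc' : c = 2 * e + 1 := by push_cast at he; omega
    rw [Finset.sum_range_succ, Finset.sum_range_one, pow_zero, pow_one] at hsq2
    set x : ℤ := (a : ℤ) ^ 2 ^ i
    have hx : Odd x := by
      rw [← Int.odd_pow' (n := 2) (by norm_num), ← hcs]; exact ⟨e, hc'⟩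
    obtain ⟨y, hy⟩ := hx
    have : c = 4 * (y * y + y) + 1 := by rw [hcs, hy]; ring
    obtain ⟨z, hz⟩ := hsq2
    push_cast at hz
    omega
  · have h4 := odd_sq_dvd_geom_sum₂_sub (1 : ℤ) e hodd
    simp only [one_pow, mul_one, ← he, add_sub_cancel] at h4
    have h5 := (Int.dvd_iff_dvd_of_dvd_sub h4).mp hsq2
    have h6 : ℓ ^ 2 ∣ ℓ := by exact_mod_cast h5
    have := Nat.le_of_dvd hℓ.pos h6
    have := hℓ.two_le
    nlinarith

theorem natAbs_cyclotomic_eval_two_le (n : ℕ) :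
    ((cyclotomic n ℤ).eval ((2 : ℕ) : ℤ)).natAbs ≤ 3 ^ n.totient := by
  have h := cyclotomic_eval_le_add_one_pow_totient (q := 2) (by norm_num) n
  have h0 := cyclotomic_nonneg n (x := (2 : ℝ)) (by norm_num)
  have e := cyclotomic.eval_apply ((2 : ℕ) : ℤ) n (algebraMap ℤ ℝ)
  simp only [algebraMap_int_eq, eq_intCast, Nat.cast_ofNat, Int.cast_ofNat] at e
  rw [← Nat.cast_le (α := ℝ), Nat.cast_natAbs, Int.cast_abs]
  push_cast
  rw [← e, abs_of_nonneg h0]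
  norm_num at h
  exact h

/-- The value is too large: for a ≥ 3 it exceeds 2^(ℓ-1) ≥ ℓ. For a = 2 write m = nℓ and compare
with Φ_n(2^ℓ), which is Φ_m(2) if ℓ ∣ n and Φ_m(2) Φ_n(2) otherwise. The only escape is ℓ = 3, n =
2, that is m = 6. -/
theorem natAbs_cyclotomic_eval_ne_of_dvd {a m ℓ : ℕ} (ha : 1 < a) (hm : 3 ≤ m)
    (h26 : ¬ (a = 2 ∧ m = 6)) (hℓ : ℓ.Prime) (hdvd : ℓ ∣ m)
    (h : (ℓ : ℤ) ∣ (cyclotomic m ℤ).eval (a : ℤ)) :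
    ((cyclotomic m ℤ).eval (a : ℤ)).natAbs ≠ ℓ := by
  intro heq
  have hl2 := hℓ.two_le
  by_cases ha2 : a = 2
  · subst ha2
    obtain ⟨n, rfl⟩ := hdvd
    rw [mul_comm] at *
    have hn0 : n ≠ 0 := by rintro rfl; simp at hm
    have hpow : ℓ + 1 ≤ 2 ^ ℓ := Nat.lt_two_pow_self
    by_cases hn : ℓ ∣ n
    · have e := cyclotomic_expand_eq_cyclotomic hℓ hn ℤ
      rw [← e, expand_eval, ← Nat.cast_pow] at heq
      have := sub_one_lt_natAbs_cyclotomic_eval (n := n) (q := 2 ^ ℓ)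
        (by have := Nat.le_of_dvd (by omega) hn; omega) (by omega)
      omega
    · have e := cyclotomic_expand_eq_cyclotomic_mul hℓ hn ℤ
      have e' := congrArg (fun f => (f.eval ((2 : ℕ) : ℤ)).natAbs) e
      simp only [expand_eval, eval_mul, Int.natAbs_mul, heq, ← Nat.cast_pow] at e'
      have hnd : n ∣ ℓ - 1 := by
        have h1 := orderOf_eq_of_dvd_cyclotomic_of_pow_mul (a := 2) (i := 1) hℓ hn (by
          rwa [pow_one, mul_comm])
        have h2 := orderOf_natCast_dvd_sub_one (a := 2) hℓ (by rw [h1]; exact hn0)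
        rwa [h1] at h2
      have hnl := Nat.le_of_dvd (by omega) hnd
      by_cases hn1 : n = 1
      · subst hn1
        rw [one_mul] at hm
        simp only [cyclotomic_one, eval_sub, eval_X, eval_one] at e'
        rw [show (((2 : ℕ) : ℤ) - 1).natAbs = 1 from rfl] at e'
        have : (2 : ℕ) ^ 3 ≤ 2 ^ ℓ := Nat.pow_le_pow_right (by norm_num) hm
        have h5 : ℓ + 2 ≤ 2 ^ ℓ := by
          obtain ⟨j, rfl⟩ := Nat.exists_eq_add_of_le hm
          have : j < 2 ^ j := Nat.lt_two_pow_self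
          rw [pow_add]; omega
        omega
      · have hl3 : ℓ ≠ 2 := by omega
        by_cases hl33 : ℓ = 3
        · subst hl33
          exact h26 ⟨rfl, by omega⟩
        · have hl4 : 4 ≤ ℓ := by omega
          have hbig : 3 * ℓ + 4 ≤ 2 ^ ℓ := by
            obtain ⟨j, rfl⟩ := Nat.exists_eq_add_of_le hl4
            have : j < 2 ^ j := Nat.lt_two_pow_self
            rw [pow_add]; omega
          have hlow := sub_one_pow_totient_lt_natAbs_cyclotomic_eval (n := n) (q := 2 ^ ℓ)
            (by omega) (by omega)
          have hup := natAbs_cyclotomic_eval_two_le n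
          have h6 : (3 * ℓ) ^ n.totient ≤ (2 ^ ℓ - 1) ^ n.totient :=
            Nat.pow_le_pow_left (by omega) _
          have h7 : ℓ ≤ ℓ ^ n.totient := Nat.le_self_pow (Nat.totient_pos.mpr (by omega)).ne' _
          rw [mul_pow] at h6
          rw [e'] at hlow
          have h8 : ℓ * ((cyclotomic n ℤ).eval ((2 : ℕ) : ℤ)).natAbs ≤ ℓ ^ n.totient * 3 ^ n.totient :=
            Nat.mul_le_mul h7 hup
          rw [mul_comm (ℓ ^ _)] at h8
          omega
  · have h1 := sub_one_pow_totient_lt_natAbs_cyclotomic_eval (n := m) (q := a) (by omega) (by omega)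
    have h2 : ℓ - 1 ≤ m.totient := by
      rw [← Nat.totient_prime hℓ]
      exact Nat.le_of_dvd (Nat.totient_pos.mpr (by omega)) (Nat.totient_dvd_of_dvd hdvd)
    have h3 : 2 ^ m.totient ≤ (a - 1) ^ m.totient := Nat.pow_le_pow_left (by omega) _
    have h4 : 2 ^ (ℓ - 1) ≤ 2 ^ m.totient := Nat.pow_le_pow_right (by norm_num) h2
    have h5 : ℓ - 1 < 2 ^ (ℓ - 1) := Nat.lt_two_pow_self
    omega

/-- A special case of Zsigmondy's theorem. -/
theorem exists_prime_orderOf_eq {a m : ℕ} (ha : 1 < a) (hm : 3 ≤ m) (h26 : ¬ (a = 2 ∧ m = 6)) :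
    ∃ R : ℕ, R.Prime ∧ orderOf (a : ZMod R) = m := by
  by_contra! hno
  set Φ := ((cyclotomic m ℤ).eval (a : ℤ)).natAbs with hΦ
  have hΦ1 : 1 < Φ := by
    have := sub_one_lt_natAbs_cyclotomic_eval (n := m) (q := a) (by omega) (by omega)
    omega
  have hdv : ∀ n : ℕ, n ∣ Φ ↔ (n : ℤ) ∣ (cyclotomic m ℤ).eval (a : ℤ) := fun n =>
    Int.natCast_dvd.symm
  have hdvm : ∀ ℓ : ℕ, ℓ.Prime → ℓ ∣ Φ → ℓ ∣ m := fun ℓ hℓ h => by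
    by_contra hm
    exact hno ℓ hℓ (orderOf_eq_of_dvd_cyclotomic hℓ hm ((hdv ℓ).mp h))
  -- Without a primitive prime, Φ has a single prime divisor: a larger one ℓ' would divide the
  -- ℓ-free part of m, which is the order of a modulo ℓ and so divides ℓ - 1.
  have hle : ∀ ℓ ℓ' : ℕ, ℓ.Prime → ℓ'.Prime → ℓ ∣ Φ → ℓ' ∣ Φ → ℓ' ≤ ℓ := by
    intro ℓ ℓ' hℓ hℓ' h h'
    by_contra! hlt
    have hm' := hdvm ℓ' hℓ' h'
    obtain ⟨i, w, hw, hmw⟩ := Nat.exists_eq_pow_mul_and_not_dvd (n := m) (by omega) ℓ hℓ.ne_one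
    have hord := orderOf_eq_of_dvd_cyclotomic_of_pow_mul hℓ hw (hmw ▸ (hdv ℓ).mp h)
    have hw0 : w ≠ 0 := by rintro rfl; simp at hw
    have h1 := orderOf_natCast_dvd_sub_one (a := a) hℓ (by rwa [hord])
    rw [hord] at h1
    rw [hmw] at hm'
    rcases hℓ'.dvd_mul.mp hm' with h2 | h2
    · have := (Nat.prime_dvd_prime_iff_eq hℓ' hℓ).mp (hℓ'.dvd_of_dvd_pow h2)
      omega
    · have := Nat.le_of_dvd (by have := hℓ.two_le; omega) (h2.trans h1)
      omega
  obtain ⟨ℓ, hℓ, hℓΦ⟩ := Nat.exists_prime_and_dvd (n := Φ) (by omega)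
  have hpow := Nat.eq_prime_pow_of_unique_prime_dvd (n := Φ) (p := ℓ) (by omega)
    fun {d} hd hdΦ => le_antisymm (hle ℓ d hℓ hd hℓΦ hdΦ) (hle d ℓ hd hℓ hdΦ hℓΦ)
  set j := Φ.primeFactorsList.length
  have hj : j < 2 := by
    by_contra! hj
    refine not_sq_dvd_cyclotomic_eval ha hm hℓ (hdvm ℓ hℓ hℓΦ) ((hdv ℓ).mp hℓΦ) ?_
    rw [← Nat.cast_pow, ← hdv, hpow]
    exact pow_dvd_pow _ hj
  have hj1 : j = 1 := by
    have : j ≠ 0 := by intro h0; rw [h0, pow_zero] at hpow; omega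
    omega
  rw [hj1, pow_one] at hpow
  exact natAbs_cyclotomic_eval_ne_of_dvd ha hm h26 hℓ (hdvm ℓ hℓ hℓΦ) ((hdv ℓ).mp hℓΦ) hpow

end PrimitivePrimeDivisors

/-! ### A normalizer criterion for Sylow subgroups. -/

section GroupTheory

-- Normalizers grow in nilpotent groups, so a strictly larger R-group would contain an R-element
-- outside S normalizing S. Hence S is Sylow, and Sylow conjugacy applies.
open scoped Pointwise in
theorem exists_conj_mem_of_isPGroup {G : Type*} [Group G] [Finite G] {R : ℕ} [Fact R.Prime]
    {S : Subgroup G} (hS : IsPGroup R S)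
    (hmax : ∀ g : G, (∃ n : ℕ, g ^ R ^ n = 1) → (∀ x ∈ S, g * x * g⁻¹ ∈ S) → g ∈ S)
    {K : Subgroup G} (hK : IsPGroup R K) : ∃ h : G, ∀ x ∈ K, h * x * h⁻¹ ∈ S := by
  have hSyl : ∀ {Q : Subgroup G}, IsPGroup R Q → S ≤ Q → Q = S := by
    intro Q hQ hSQ
    by_contra hne
    have := hQ.isNilpotent
    have hlt : S.subgroupOf Q < ⊤ := by
      rw [lt_top_iff_ne_top, Ne, Subgroup.subgroupOf_eq_top]
      exact fun h => hne (le_antisymm h hSQ)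
    obtain ⟨g, hg, hgS⟩ := SetLike.exists_of_lt (Group.normalizerCondition_of_isNilpotent _ hlt)
    refine hgS (Subgroup.mem_subgroupOf.mpr (hmax g ?_ fun x hx => ?_))
    · obtain ⟨n, hn⟩ := hQ g
      exact ⟨n, by simpa using congrArg Subtype.val hn⟩
    · have := (Subgroup.mem_normalizer_iff.mp hg ⟨x, hSQ hx⟩).mp (Subgroup.mem_subgroupOf.mpr hx)
      simpa [Subgroup.mem_subgroupOf] using this
  let P : Sylow R G := ⟨S, hS, hSyl⟩
  obtain ⟨Q, hQ⟩ := hK.exists_le_sylow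
  obtain ⟨h, hh⟩ := MulAction.exists_smul_eq G Q P
  refine ⟨h, fun x hx => ?_⟩
  have h1 : MulAut.conj h • x ∈ MulAut.conj h • (Q : Subgroup G) :=
    Subgroup.smul_mem_pointwise_smul _ _ _ (hQ hx)
  have h2 : ((h • Q : Sylow R G) : Subgroup G) = S := by rw [hh]
  rw [← h2]
  exact h1

end GroupTheory

/-! ### Consequences of p having order m modulo R. -/

section PrimitiveOrder

set_option linter.unusedSectionVars false

theorem prime_dvd_pow_sub_one_iff {a R m d : ℕ} (ha : 0 < a)
    (hord : orderOf (a : ZMod R) = m) : R ∣ a ^ d - 1 ↔ m ∣ d := by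
  rw [← hord, orderOf_dvd_iff_pow_eq_one, ← ZMod.natCast_eq_zero_iff, Nat.cast_sub
    (Nat.one_le_pow _ _ ha), sub_eq_zero]
  push_cast
  rfl

variable {F : Type*} [Field F] {p m : ℕ} [Fact p.Prime] [CharP F p]
  [NeZero m] [Fact (Nat.card F = p ^ m)]

/-- The order of u divides both a power of R and p^i - 1, and R divides p^i - 1 only when m ∣ i. -/
theorem eq_one_of_fr_eq_self {R : ℕ} [hR : Fact R.Prime] (hord : orderOf (p : ZMod R) = m)
    {i : ZMod m} (hi : i ≠ 0) {u : F} (hu : fr F p i u = u) (h : ∃ n : ℕ, u ^ R ^ n = 1) :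
    u = 1 := by
  obtain ⟨n, hn⟩ := h
  have hp : 1 < p := (Fact.out : p.Prime).one_lt
  have hRn : R ^ n ≠ 0 := pow_ne_zero _ hR.out.ne_zero
  have hu0 : u ≠ 0 := by rintro rfl; rw [zero_pow hRn] at hn; exact zero_ne_one hn
  have h1 : u ^ (p ^ i.val - 1) = 1 := by
    refine mul_right_cancel₀ hu0 ?_
    rw [← pow_succ, Nat.sub_add_cancel (Nat.one_le_pow _ _ (by omega)), one_mul]
    exact hu
  have hcop : Nat.Coprime (R ^ n) (p ^ i.val - 1) := by
    refine Nat.Coprime.pow_left _ ((Nat.Prime.coprime_iff_not_dvd hR.out).mpr fun hd => hi ?_)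
    rw [prime_dvd_pow_sub_one_iff (by omega) hord] at hd
    have := Nat.eq_zero_of_dvd_of_lt hd (ZMod.val_lt i)
    exact (ZMod.val_eq_zero i).mp this
  have h2 := Nat.dvd_gcd (orderOf_dvd_of_pow_eq_one hn) (orderOf_dvd_of_pow_eq_one h1)
  rw [hcop.gcd_eq_one, Nat.dvd_one] at h2
  exact orderOf_eq_one_iff.mp h2

theorem coprime_of_orderOf_eq {R : ℕ} [hR : Fact R.Prime] (hord : orderOf (p : ZMod R) = m) :
    Nat.Coprime R m := by
  have hm : 0 < m := NeZero.pos m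
  have h1 : m ∣ R - 1 := by
    rw [← hord]; exact orderOf_natCast_dvd_sub_one hR.out (by rw [hord]; omega)
  have h2 := hR.out.two_le
  refine (Nat.Prime.coprime_iff_not_dvd hR.out).mpr fun h => ?_
  have h3 := Nat.le_of_dvd hm h
  have h4 := Nat.le_of_dvd (by omega) h1
  omega

theorem odd_of_orderOf_eq {R : ℕ} [hR : Fact R.Prime] (hord : orderOf (p : ZMod R) = m)
    (hm : 1 < m) : Odd R := by
  refine (hR.out.eq_two_or_odd').resolve_left fun h2 => ?_
  have h1 : m ∣ R - 1 := by
    rw [← hord]; exact orderOf_natCast_dvd_sub_one hR.out (by rw [hord]; omega)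
  have := Nat.le_of_dvd (by omega) h1
  omega

theorem exists_unit_orderOf_eq (F : Type*) [Field F] (p : ℕ) {m R : ℕ} [Fact p.Prime]
    [Fact (Nat.card F = p ^ m)] [Fact R.Prime] (hord : orderOf (p : ZMod R) = m) :
    ∃ c : Fˣ, orderOf c = R := by
  have := finite_of_card F p m
  have := Fintype.ofFinite F
  classical
  have hF : Nat.card F = p ^ m := Fact.out
  refine exists_prime_orderOf_dvd_card R ?_
  rw [← Nat.card_eq_fintype_card, Nat.card_units, hF,
    prime_dvd_pow_sub_one_iff (Fact.out : p.Prime).pos hord]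

/-- A subfield with p^n elements containing an element of order R has R ∣ p^n - 1, hence m ∣ n. -/
theorem subfield_eq_top {R : ℕ} (hord : orderOf (p : ZMod R) = m)
    (K : Subfield F) {c : Fˣ} (hc : orderOf c = R) (hcK : (c : F) ∈ K) : K = ⊤ := by
  have := finite_of_card F p m
  have := Fintype.ofFinite F
  have := Fintype.ofFinite K
  have hF : Nat.card F = p ^ m := Fact.out
  have hp : 1 < p := (Fact.out : p.Prime).one_lt
  have : CharP K p := (K.subtype.charP_iff K.subtype.injective p).mpr inferInstance
  obtain ⟨n, -, hn⟩ := FiniteField.card K p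
  have h1 : c ^ (p ^ (n : ℕ) - 1) = 1 := by
    have h2 := FiniteField.pow_card_sub_one_eq_one (⟨c, hcK⟩ : K) (by
      intro h0; exact c.ne_zero (congrArg Subtype.val h0))
    rw [hn] at h2
    ext
    simpa using congrArg Subtype.val h2
  have h2 := orderOf_dvd_of_pow_eq_one h1
  rw [hc, prime_dvd_pow_sub_one_iff (by omega) hord] at h2
  have h3 := Nat.le_of_dvd n.pos h2
  have h4 : Nat.card F ≤ Nat.card K := by
    rw [hF, Nat.card_eq_fintype_card, hn]; exact Nat.pow_le_pow_right (by omega) h3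
  have h5 : (K : Set F) = Set.univ := Set.eq_of_subset_of_ncard_le (Set.subset_univ _) (by
    rw [Set.ncard_univ]; exact h4)
  exact SetLike.coe_injective h5

end PrimitiveOrder

/-! ### Autotopism groups, scalars and semilinear maps. -/

section Autotopisms

set_option linter.unusedSectionVars false

variable {F : Type*} [Field F] {p m : ℕ} [Fact p.Prime] [CharP F p]
  [NeZero m] [Fact (Nat.card F = p ^ m)] [Algebra (ZMod p) F]

/-- The scalars that L carries to scalars form a subfield containing `c`, hence all of F; the
induced map on F is a field automorphism. -/
theorem exists_semilinear {R : ℕ} (hord : orderOf (p : ZMod R) = m)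
    (L : (F × F) ≃ₗ[ZMod p] (F × F)) {c : Fˣ} (hc : orderOf c = R) {c' : F}
    (h : ∀ X, L ((c : F) • X) = c' • L X) :
    ∃ t : ZMod m, fr F p t c = c' ∧ ∀ (x : F) X, L (x • X) = fr F p t x • L X := by
  let K : Subfield F :=
    { carrier := {x | ∃ x' : F, ∀ X, L (x • X) = x' • L X}
      mul_mem' := by
        rintro x y ⟨x', hx⟩ ⟨y', hy⟩
        exact ⟨x' * y', fun X => by rw [mul_smul, hx, hy, mul_smul]⟩
      one_mem' := ⟨1, fun X => by simp⟩
      add_mem' := by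
        rintro x y ⟨x', hx⟩ ⟨y', hy⟩
        exact ⟨x' + y', fun X => by rw [add_smul, map_add, hx, hy, add_smul]⟩
      zero_mem' := ⟨0, fun X => by simp⟩
      neg_mem' := by
        rintro x ⟨x', hx⟩
        exact ⟨-x', fun X => by rw [neg_smul, map_neg, hx, neg_smul]⟩
      inv_mem' := by
        rintro x ⟨x', hx⟩
        by_cases hx0 : x = 0
        · exact ⟨0, fun X => by simp [hx0]⟩
        · have hx0' : x' ≠ 0 := by
            rintro rfl
            have h1 := hx (1, 0)
            rw [zero_smul, LinearEquiv.map_eq_zero_iff] at h1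
            simp [hx0] at h1
          refine ⟨x'⁻¹, fun X => ?_⟩
          have h1 := hx (x⁻¹ • X)
          rw [smul_inv_smul₀ hx0] at h1
          rw [h1, inv_smul_smul₀ hx0'] }
  have hK : K = ⊤ := subfield_eq_top (p := p) hord K hc ⟨c', h⟩
  have hall : ∀ x : F, ∃ x' : F, ∀ X, L (x • X) = x' • L X := fun x => by
    have : x ∈ K := hK ▸ Subfield.mem_top x
    exact this
  choose τ hτ using hall
  have huniq : ∀ x y : F, (∀ X, x • L X = y • L X) → x = y := by
    intro x y hxy
    have := hxy (L.symm (1, 0))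
    simpa using this
  let τ' : F →+* F :=
    { toFun := τ
      map_one' := huniq _ _ fun X => by rw [← hτ, one_smul, one_smul]
      map_mul' := fun x y => huniq _ _ fun X => by rw [← hτ, mul_smul, hτ, hτ, mul_smul]
      map_zero' := huniq _ _ fun X => by rw [← hτ, zero_smul, zero_smul, map_zero]
      map_add' := fun x y => huniq _ _ fun X => by
        rw [← hτ, add_smul, map_add, hτ, hτ, add_smul] }
  obtain ⟨t, ht⟩ := exists_eq_fr m τ'
  have ht' : ∀ x, τ x = fr F p t x := fun x => DFunLike.congr_fun ht x
  refine ⟨t, ?_, fun x X => by rw [← ht', hτ]⟩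
  rw [← ht']
  exact huniq _ _ fun X => by rw [← hτ, h]

/-- The pairs `(L, M)` which occur in autotopisms `(N, L, M)` of a multiplication. -/
def autotopismGroup {p : ℕ} {V : Type*} [AddCommGroup V] [Module (ZMod p) V] (μ : V → V → V) :
    Subgroup ((V ≃ₗ[ZMod p] V) × (V ≃ₗ[ZMod p] V)) where
  carrier := {g | ∃ N : V ≃ₗ[ZMod p] V, ∀ X Y, N (μ X Y) = μ (g.1 X) (g.2 Y)}
  mul_mem' := by
    rintro g h ⟨N, hN⟩ ⟨N', hN'⟩
    exact ⟨N * N', fun X Y => by simp [hN', hN]⟩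
  one_mem' := ⟨1, fun X Y => rfl⟩
  inv_mem' := by
    rintro g ⟨N, hN⟩
    refine ⟨N⁻¹, fun X Y => N.injective ?_⟩
    rw [hN, ← LinearEquiv.mul_apply, ← LinearEquiv.mul_apply, ← LinearEquiv.mul_apply,
      mul_inv_cancel, Prod.fst_inv, Prod.snd_inv, mul_inv_cancel, mul_inv_cancel]
    rfl

/-- The homomorphism taking a scalar to the pair of its multiplication maps. -/
noncomputable def scalarPair (F : Type*) [Field F] (p : ℕ) [Algebra (ZMod p) F] :
    Fˣ →* ((F × F) ≃ₗ[ZMod p] (F × F)) × ((F × F) ≃ₗ[ZMod p] (F × F)) :=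
  (DistribMulAction.toModuleAut (ZMod p) (F × F)).prod
    (DistribMulAction.toModuleAut (ZMod p) (F × F))

theorem scalarPair_fst (c : Fˣ) (X : F × F) : (scalarPair F p c).1 X = (c : F) • X := rfl

theorem scalarPair_snd (c : Fˣ) (X : F × F) : (scalarPair F p c).2 X = (c : F) • X := rfl

/-- The product of two Frobenius-semilinear bijections of `F`. -/
noncomputable def frProd (p : ℕ) [Fact p.Prime] [CharP F p] [Algebra (ZMod p) F]
    [Fact (Nat.card F = p ^ m)] (A D : Fˣ) (i j : ZMod m) : (F × F) ≃ₗ[ZMod p] (F × F) :=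
  have := finite_of_card F p m
  LinearEquiv.ofBijective
    (AddMonoidHom.toZModLinearMap p
      { toFun := fun X : F × F => ((A : F) * fr F p i X.1, (D : F) * fr F p j X.2)
        map_zero' := by simp
        map_add' := fun X Y => by simp [mul_add] })
    (Finite.injective_iff_bijective.mp fun X Y h => by
      have h' : ((A : F) * fr F p i X.1, (D : F) * fr F p j X.2)
        = ((A : F) * fr F p i Y.1, (D : F) * fr F p j Y.2) := h
      simp only [Prod.mk.injEq, mul_right_inj' A.ne_zero, mul_right_inj' D.ne_zero] at h'
      exact Prod.ext ((fr F p i).injective h'.1) ((fr F p j).injective h'.2))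

theorem frProd_apply (A D : Fˣ) (i j : ZMod m) (X : F × F) :
    frProd p A D i j X = ((A : F) * fr F p i X.1, (D : F) * fr F p j X.2) := rfl

/-- The two coordinates of the product scale by c^(q+1) and c^(q²+1). -/
theorem scalarPair_mem_autotopismGroup (m : ℕ) [NeZero m] [Fact (Nat.card F = p ^ m)] (k : ℕ) (α a b : F) (c : Fˣ) :
    scalarPair F p c ∈ autotopismGroup (p := p) (taniguchiMul (p ^ k) α a b) := by
  let s : ZMod m := k
  have e : ∀ i : ZMod m, (fr F p i c : F) * c ≠ 0 := fun i => mul_ne_zero (by simp) c.ne_zero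
  refine ⟨frProd (m := m) p (Units.mk0 _ (e s)) (Units.mk0 _ (e (2 * s))) 0 0, fun X Y => ?_⟩
  rw [frProd_apply, scalarPair_fst, scalarPair_snd, taniguchiMul_smul (m := m),
    taniguchiMul_eq (m := m)]
  simp only [fr_zero, Units.val_mk0]
  refine Prod.ext ?_ ?_ <;> simp only [s] <;> ring

end Autotopisms

/-! ### Sylow argument making isotopisms semilinear. -/

section Reduction

set_option linter.unusedSectionVars false

variable {F : Type*} [Field F] {p m : ℕ} [Fact p.Prime] [CharP F p]
  [NeZero m] [Fact (Nat.card F = p ^ m)] [Algebra (ZMod p) F]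

theorem exists_linearEquiv_eq (L : (F × F) ≃ₗ[ZMod p] (F × F))
    (h : ∀ (x : F) X, L (x • X) = x • L X) :
    ∃ L' : (F × F) ≃ₗ[F] (F × F), ∀ X, L' X = L X :=
  ⟨{ L with map_smul' := h }, fun _ => rfl⟩

theorem pow_apply_smul {L : (F × F) ≃ₗ[ZMod p] (F × F)} {t : ZMod m}
    (h : ∀ (x : F) X, L (x • X) = fr F p t x • L X) (j : ℕ) (x : F) (X : F × F) :
    (L ^ j) (x • X) = fr F p ((j : ZMod m) * t) x • (L ^ j) X := by
  induction j with
  | zero => simp [fr_zero]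
  | succ j ih =>
    rw [pow_succ', LinearEquiv.mul_apply, ih, h, ← fr_add, ← LinearEquiv.mul_apply]
    congr 3
    push_cast; ring

/-- The accompanying automorphism has R-power order in a cyclic group of order m, which is prime to
R. -/
theorem smul_comm_of_pow_eq_one {R : ℕ} [Fact R.Prime] (hord : orderOf (p : ZMod R) = m)
    {L : (F × F) ≃ₗ[ZMod p] (F × F)} {t : ZMod m} (h : ∀ (x : F) X, L (x • X) = fr F p t x • L X)
    {n : ℕ} (hn : L ^ R ^ n = 1) (x : F) (X : F × F) : L (x • X) = x • L X := by
  have h1 : ∀ y : F, fr F p (((R ^ n : ℕ) : ZMod m) * t) y = y := by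
    intro y
    have := pow_apply_smul h (R ^ n) y (1, 0)
    rw [hn] at this
    simpa using this.symm
  have h2 : ((R ^ n : ℕ) : ZMod m) * t = 0 := by
    refine fr_injective (F := F) (p := p) (RingHom.ext fun y => ?_)
    rw [h1, fr_zero]
  have hu : IsUnit ((R ^ n : ℕ) : ZMod m) :=
    (ZMod.isUnit_iff_coprime _ _).mpr (Nat.Coprime.pow_left _ (coprime_of_orderOf_eq hord))
  rw [(hu.mul_right_eq_zero).mp h2] at h
  simpa [fr_zero] using h x X

theorem pow_apply_of_diag {L : (F × F) ≃ₗ[ZMod p] (F × F)} {A D : F}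
    (h : ∀ x y, L (x, y) = (A * x, D * y)) (j : ℕ) (x y : F) :
    (L ^ j) (x, y) = (A ^ j * x, D ^ j * y) := by
  induction j with
  | zero => simp
  | succ j ih => rw [pow_succ', LinearEquiv.mul_apply, ih, h, pow_succ, pow_succ]; ring_nf

theorem pow_eq_one_of_diag {L : (F × F) ≃ₗ[ZMod p] (F × F)} {A D : F}
    (h : ∀ x y, L (x, y) = (A * x, D * y)) {j : ℕ} (hj : L ^ j = 1) : A ^ j = 1 ∧ D ^ j = 1 := by
  have := pow_apply_of_diag h j 1 1
  rw [hj] at this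
  simpa [eq_comm] using this

theorem pow_ne_one_of_antidiag {L : (F × F) ≃ₗ[ZMod p] (F × F)} {B C : F}
    (h : ∀ x y, L (x, y) = (B * y, C * x)) {j : ℕ} (hodd : Odd j) : L ^ j ≠ 1 := by
  obtain ⟨i, rfl⟩ := hodd
  have h1 : ∀ x y, (L ^ 2) (x, y) = (B * C * x, C * B * y) := fun x y => by
    rw [pow_two, LinearEquiv.mul_apply, h, h, mul_assoc, mul_assoc]
  intro h2
  rw [pow_succ', pow_mul] at h2
  have h3 := congrArg (fun f : (F × F) ≃ₗ[ZMod p] (F × F) => f (1, 0)) h2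
  simp only [LinearEquiv.mul_apply, pow_apply_of_diag h1, h] at h3
  simpa using congrArg Prod.fst h3

/-- This is the maximality condition showing that the R-part of the scalars is a Sylow subgroup. -/
theorem exists_scalarPair_eq_of_normalizes {R : ℕ} [Fact R.Prime]
    (hord : orderOf (p : ZMod R) = m) (hm : 1 < m) {k : ℕ} {α a b : F} {s : ZMod m} (hs : s = k)
    (h2 : 2 * s ≠ 0) (hα : ∀ z : F, z ≠ 0 → fr F p s z ≠ -α * z) (hα0 : α ≠ 0) (hb : b ≠ 0)
    {g : ((F × F) ≃ₗ[ZMod p] (F × F)) × ((F × F) ≃ₗ[ZMod p] (F × F))}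
    (hg : g ∈ autotopismGroup (taniguchiMul (p ^ k) α a b)) (hgR : ∃ n : ℕ, g ^ R ^ n = 1)
    (hnorm : ∀ c ∈ CommGroup.primaryComponent Fˣ R, ∃ c' : Fˣ,
      g * scalarPair F p c * g⁻¹ = scalarPair F p c') :
    ∃ c ∈ CommGroup.primaryComponent Fˣ R, scalarPair F p c = g := by
  obtain ⟨n, hn⟩ := hgR
  obtain ⟨N, hN⟩ := hg
  obtain ⟨c, hc⟩ := exists_unit_orderOf_eq F p (m := m) hord
  obtain ⟨c', hc'⟩ := hnorm c ⟨1, by rw [pow_one, ← hc, pow_orderOf_eq_one]⟩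
  rw [mul_inv_eq_iff_eq_mul] at hc'
  have hL : ∀ X, g.1 ((c : F) • X) = (c' : F) • g.1 X := fun X =>
    congrArg (fun f : ((F × F) ≃ₗ[ZMod p] (F × F)) × _ => f.1 X) hc'
  have hM : ∀ X, g.2 ((c : F) • X) = (c' : F) • g.2 X := fun X =>
    congrArg (fun f : _ × ((F × F) ≃ₗ[ZMod p] (F × F)) => f.2 X) hc'
  obtain ⟨t₁, -, ht₁⟩ := exists_semilinear hord g.1 hc hL
  obtain ⟨t₂, -, ht₂⟩ := exists_semilinear hord g.2 hc hM
  have hn1 : g.1 ^ R ^ n = 1 := congrArg Prod.fst hn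
  have hn2 : g.2 ^ R ^ n = 1 := congrArg Prod.snd hn
  obtain ⟨L, hL'⟩ := exists_linearEquiv_eq g.1 (smul_comm_of_pow_eq_one hord ht₁ hn1)
  obtain ⟨M, hM'⟩ := exists_linearEquiv_eq g.2 (smul_comm_of_pow_eq_one hord ht₂ hn2)
  have hN' : ∀ X Y, N (taniguchiMul (p ^ k) α a b X Y) = taniguchiMul (p ^ k) α a b (L X) (M Y) :=
    fun X Y => by rw [hN, hL', hM']
  have hs0 : s ≠ 0 := by rintro rfl; simp at h2
  rcases diag_or_antidiag hs h2 hα hα0 hb hN' with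
    ⟨A, D, A', D', hA, hD, hA', hD', hLd, hMd, h⟩ | ⟨B, C, B', C', hB, hC, hB', hC', hLd, -, -⟩
  · simp only [hL'] at hLd
    simp only [hM'] at hMd
    obtain ⟨hAn, hDn⟩ := pow_eq_one_of_diag hLd hn1
    obtain ⟨-, hDn'⟩ := pow_eq_one_of_diag hMd hn2
    obtain ⟨t, ht, rfl, rfl, h3, -, h5⟩ := exists_of_diagRel hA hD hA' hD' h
    -- Here α' = α, so t is fixed by σ.
    have ht1 : t = 1 := eq_one_of_fr_eq_self hord hs0 (mul_left_cancel₀ hα0 h3)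
      ⟨n, by rwa [mul_pow, hDn, one_mul] at hDn'⟩
    subst ht1
    simp only [map_one, mul_one] at *
    have hσD : fr F p s D ≠ 0 := by simpa using hD
    have hr : fr F p s (A / D) * (A / D) = 1 := by
      rw [map_div₀]
      field_simp
      exact mul_left_cancel₀ hb (by linear_combination -h5)
    -- For r = A/D, the relation σ(r) r = 1 makes r fixed by σ², which is nontrivial because 2s ≠ 0.
    have hr2 : fr F p (2 * s) (A / D) = A / D := by
      have h6 := congrArg (fr F p s) hr
      rw [map_mul, map_one, ← fr_two_mul] at h6
      have h7 : fr F p s (A / D) ≠ 0 := left_ne_zero_of_mul_eq_one hr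
      exact mul_right_cancel₀ h7 (by rw [h6, mul_comm, hr])
    have hr1 := eq_one_of_fr_eq_self hord h2 hr2 ⟨n, by rw [div_pow, hAn, hDn, one_div_one]⟩
    have hAD : A = D := by field_simp at hr1; exact hr1
    subst hAD
    refine ⟨Units.mk0 A hA, ⟨n, by ext; simpa using hAn⟩, ?_⟩
    refine Prod.ext (LinearEquiv.ext fun X => ?_) (LinearEquiv.ext fun X => ?_)
    · rw [scalarPair_fst, hLd X.1 X.2]; rfl
    · rw [scalarPair_snd, hMd X.1 X.2]; rfl
  · simp only [hL'] at hLd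
    -- R is odd, and an odd power of an antidiagonal map is again antidiagonal.
    exact absurd hn1 (pow_ne_one_of_antidiag hLd (Odd.pow (odd_of_orderOf_eq hord hm)))

/-- The isotopism conjugates the scalars of the second multiplication into the autotopism group of
the first. Composing with an autotopism from Sylow conjugacy brings their R-part back into the
scalars, so the new L and M carry an element of order R to a scalar. -/
theorem exists_semilinear_isotopism {R : ℕ} [Fact R.Prime]
    (hord : orderOf (p : ZMod R) = m) (hm : 1 < m) {k₁ k₂ : ℕ} {α a b α' a' b' : F} {s : ZMod m}
    (hs : s = k₁) (h2 : 2 * s ≠ 0) (hα : ∀ z : F, z ≠ 0 → fr F p s z ≠ -α * z) (hα0 : α ≠ 0)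
    (hb : b ≠ 0)
    (h : Isotopic p (taniguchiMul (p ^ k₁) α a b) (taniguchiMul (p ^ k₂) α' a' b')) :
    ∃ t : ZMod m, ∃ N L M : (F × F) ≃ₗ[ZMod p] (F × F),
      (∀ X Y, N (taniguchiMul (p ^ k₁) α a b X Y) = taniguchiMul (p ^ k₂) α' a' b' (L X) (M Y)) ∧
      (∀ (x : F) X, L (fr F p t x • X) = x • L X) ∧
      ∀ (x : F) X, M (fr F p t x • X) = x • M X := by
  have := finite_of_card F p m
  obtain ⟨N, L, M, hN⟩ := h
  set H := autotopismGroup (p := p) (taniguchiMul (p ^ k₁) α a b) with hH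
  have : Finite ((F × F) ≃ₗ[ZMod p] (F × F)) := DFunLike.finite _
  let γ : ((F × F) ≃ₗ[ZMod p] (F × F)) × ((F × F) ≃ₗ[ZMod p] (F × F)) := (L, M)
  let f₁ : Fˣ →* H := (scalarPair F p).codRestrict H (scalarPair_mem_autotopismGroup m k₁ α a b)
  let f₂ : Fˣ →* H := ((MulAut.conj γ⁻¹).toMonoidHom.comp (scalarPair F p)).codRestrict H (by
    intro c
    obtain ⟨N', hN'⟩ := scalarPair_mem_autotopismGroup m k₂ α' a' b' c
    refine ⟨(N.trans N').trans N.symm, fun X Y => N.injective ?_⟩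
    rw [LinearEquiv.trans_apply, LinearEquiv.trans_apply, LinearEquiv.apply_symm_apply, hN, hN', hN]
    congr 1
    · exact (L.apply_symm_apply _).symm
    · exact (M.apply_symm_apply _).symm)
  have hT : IsPGroup R (CommGroup.primaryComponent Fˣ R) := CommGroup.primaryComponent.isPGroup
  obtain ⟨h, hh⟩ := exists_conj_mem_of_isPGroup (hT.map f₁) (fun g hg hnorm => by
    obtain ⟨c, hc, hc'⟩ := exists_scalarPair_eq_of_normalizes hord hm hs h2 hα hα0 hb g.2
      (hg.imp fun n hn => by simpa using congrArg Subtype.val hn) (fun c hc => by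
        obtain ⟨c', -, hc'⟩ := hnorm (f₁ c) (Subgroup.mem_map_of_mem _ hc)
        exact ⟨c', (congrArg Subtype.val hc').symm⟩)
    exact ⟨c, hc, Subtype.ext hc'⟩) (hT.map f₂)
  obtain ⟨c, hc⟩ := exists_unit_orderOf_eq F p (m := m) hord
  obtain ⟨c', -, hc'⟩ := hh (f₂ c) (Subgroup.mem_map_of_mem _
    ⟨1, by rw [pow_one, ← hc, pow_orderOf_eq_one]⟩)
  have hc'' : scalarPair F p c' * (h.1 * γ⁻¹) = (h.1 * γ⁻¹) * scalarPair F p c := by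
    have : scalarPair F p c' = h.1 * (γ⁻¹ * scalarPair F p c * γ⁻¹⁻¹) * h.1⁻¹ :=
      congrArg Subtype.val hc'
    rw [this]; group
  set δ := h.1 * γ⁻¹ with hδ
  have hL : ∀ X, δ.1 ((c : F) • X) = (c' : F) • δ.1 X := fun X =>
    (congrArg (fun f : ((F × F) ≃ₗ[ZMod p] (F × F)) × _ => f.1 X) hc'').symm
  have hM : ∀ X, δ.2 ((c : F) • X) = (c' : F) • δ.2 X := fun X =>
    (congrArg (fun f : _ × ((F × F) ≃ₗ[ZMod p] (F × F)) => f.2 X) hc'').symm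
  obtain ⟨t, ht, ht₁⟩ := exists_semilinear hord δ.1 hc hL
  obtain ⟨t', ht', ht₂⟩ := exists_semilinear hord δ.2 hc hM
  -- Both automorphisms send `c`, of order R, to the same `c'`, so their quotient fixes `c` and is
  -- trivial.
  have htt : t = t' := by
    by_contra hne
    have h1 : fr F p (t - t') (c : F) = c := by
      apply (fr F p t').injective
      rw [← fr_add, add_sub_cancel, ht, ht']
    have h3 := eq_one_of_fr_eq_self (R := R) hord (sub_ne_zero.mpr hne) h1
      ⟨1, by rw [pow_one, ← hc, ← Units.val_pow_eq_pow_val, pow_orderOf_eq_one, Units.val_one]⟩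
    have h4 : c = 1 := Units.ext h3
    rw [h4, orderOf_one] at hc
    exact (Fact.out : R.Prime).one_lt.ne hc
  subst htt
  obtain ⟨N', hN'⟩ := h.2
  have hcancel : δ * (γ * h.1⁻¹) = 1 := by rw [hδ]; group
  have hδ1 : ∀ X, δ.1 ((γ * h.1⁻¹).1 X) = X := fun X =>
    congrArg (fun f : ((F × F) ≃ₗ[ZMod p] (F × F)) × _ => f.1 X) hcancel
  have hδ2 : ∀ X, δ.2 ((γ * h.1⁻¹).2 X) = X := fun X =>
    congrArg (fun f : _ × ((F × F) ≃ₗ[ZMod p] (F × F)) => f.2 X) hcancel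
  obtain ⟨N'', hN''⟩ := (h⁻¹).2
  refine ⟨t, N * N'', (γ * h.1⁻¹).1, (γ * h.1⁻¹).2, fun X Y => ?_, fun x X => ?_, fun x X => ?_⟩
  · rw [LinearEquiv.mul_apply, hN'', hN]; rfl
  · apply δ.1.injective
    rw [hδ1, ht₁, hδ1]
  · apply δ.2.injective
    rw [hδ2, ht₂, hδ2]

end Reduction

/-! ### Isotopy criteria in terms of the parameters. -/

section Taniguchi

set_option linter.unusedSectionVars false

variable {F : Type*} [Field F] {p m : ℕ} [Fact p.Prime] [CharP F p]
  [NeZero m] [Fact (Nat.card F = p ^ m)] [Algebra (ZMod p) F]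

theorem fr_taniguchiMul (t : ZMod m) (q : ℕ) (α a b : F) (X Y : F × F) :
    frProd p 1 1 t t (taniguchiMul q α a b X Y) =
      taniguchiMul q (fr F p t α) (fr F p t a) (fr F p t b) (frProd p 1 1 t t X)
        (frProd p 1 1 t t Y) := by
  simp [frProd_apply, taniguchiMul]

/-- Precomposing with a coordinatewise Frobenius power cancels the semilinearity, at the cost of
twisting the parameters. -/
theorem exists_linear_isotopism {R : ℕ} [Fact R.Prime]
    (hord : orderOf (p : ZMod R) = m) (hm : 1 < m) {k₁ k₂ : ℕ} {α a b α' a' b' : F} {s : ZMod m}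
    (hs : s = k₁) (h2 : 2 * s ≠ 0) (hα : ∀ z : F, z ≠ 0 → fr F p s z ≠ -α * z) (hα0 : α ≠ 0)
    (hb : b ≠ 0)
    (h : Isotopic p (taniguchiMul (p ^ k₁) α a b) (taniguchiMul (p ^ k₂) α' a' b')) :
    ∃ i : ZMod m, ∃ N : (F × F) ≃ₗ[ZMod p] (F × F), ∃ L M : (F × F) ≃ₗ[F] (F × F),
      ∀ X Y, N (taniguchiMul (p ^ k₁) (fr F p i α) (fr F p i a) (fr F p i b) X Y)
        = taniguchiMul (p ^ k₂) α' a' b' (L X) (M Y) := by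
  obtain ⟨t, N, L, M, hN, hL, hM⟩ := exists_semilinear_isotopism hord hm hs h2 hα hα0 hb h
  have hφ : ∀ (x : F) (X : F × F), frProd p 1 1 t t (x • X) = fr F p t x • frProd p 1 1 t t X := fun x X => by
    simp [frProd_apply]
  obtain ⟨L', hL'⟩ := exists_linearEquiv_eq ((frProd p 1 1 t t).trans L) fun x X => by
    rw [LinearEquiv.trans_apply, hφ, hL, LinearEquiv.trans_apply]
  obtain ⟨M', hM'⟩ := exists_linearEquiv_eq ((frProd p 1 1 t t).trans M) fun x X => by
    rw [LinearEquiv.trans_apply, hφ, hM, LinearEquiv.trans_apply]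
  refine ⟨-t, (frProd p 1 1 t t).trans N, L', M', fun X Y => ?_⟩
  rw [LinearEquiv.trans_apply, fr_taniguchiMul, hL', hM', fr_fr_neg, fr_fr_neg, fr_fr_neg, hN]
  rfl

/-- `DiagRel` records only part of the coefficient identities; the two extra hypotheses supply those
for y v^q and y^q u. -/
theorem isotopic_of_diagRel {k : ℕ} {α a b α' a' b' A D A' D' : F} {s : ZMod m} (hs : s = k)
    (t : ZMod m) (hA : A ≠ 0) (hD : D ≠ 0) (hA' : A' ≠ 0) (hD' : D' ≠ 0)
    (hα : α' * fr F p s D' * D = fr F p t α * D' * fr F p s D)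
    (ha : a' * fr F p s α' * fr F p s D * A' = fr F p s A * A' * fr F p t a * fr F p s (fr F p t α))
    (h : DiagRel p s (fr F p t α) (fr F p t a) (fr F p t b) α' a' b' A D A' D') :
    Isotopic p (taniguchiMul (p ^ k) α a b) (taniguchiMul (p ^ k) α' a' b') := by
  obtain ⟨n, rfl, h1, h2, h3, h4⟩ := h
  have hn : fr F p s A * A' ≠ 0 := mul_ne_zero (by simpa using hA) hA'
  have hg : A * fr F p (2 * s) D' ≠ 0 := mul_ne_zero hA (by simpa using hD')
  have hα₂ : b' * α' * D * fr F p s D' = fr F p s A * A' * fr F p t b * fr F p t α := by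
    linear_combination b' * hα + fr F p t α * h3
  refine ⟨frProd p (Units.mk0 _ hn) (Units.mk0 _ hg) t t, frProd p (Units.mk0 A hA)
    (Units.mk0 D hD) t t, frProd p (Units.mk0 A' hA') (Units.mk0 D' hD') t t, fun X Y => ?_⟩
  have hφ := fr_taniguchiMul t (p ^ k) α a b X Y
  simp only [frProd_apply, Units.val_one, one_mul, Prod.ext_iff, Units.val_mk0] at hφ ⊢
  rw [hφ.1, hφ.2, taniguchiMul_eq (m := m), taniguchiMul_eq (m := m), ← hs]
  generalize fr F p t X.1 = x
  generalize fr F p t X.2 = y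
  generalize fr F p t Y.1 = u
  generalize fr F p t Y.2 = v
  constructor
  · simp only [formP, formQ, map_mul]
    linear_combination (-(x * fr F p s u)) * h1 + x * fr F p s v * h2 + fr F p s y * v * h3
      - fr F p s y * u * ha + y * fr F p s v * hα₂
  · simp only [formG, formH, map_mul]
    linear_combination fr F p (2 * s) y * u * h4

theorem IsTaniguchi.ne_zero {k : ℕ} {α a b : F} (h : IsTaniguchi p m k α a b) : α ≠ 0 ∧ b ≠ 0 := by
  have hp : 1 < p := (Fact.out : p.Prime).one_lt
  have h1 : 1 < p ^ k := Nat.one_lt_pow (by have := h.one_le; omega) hp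
  refine ⟨fun h0 => h.not_pow ⟨0, ?_⟩, fun h0 => h.no_root 0 ?_⟩
  · rw [h0, neg_zero, zero_pow (by omega)]
  · rw [h0, zero_pow (by omega)]; simp

theorem IsTaniguchi.fr_ne {k : ℕ} {α a b : F} (h : IsTaniguchi p m k α a b) (z : F) (hz : z ≠ 0) :
    fr F p (k : ZMod m) z ≠ -α * z := by
  have hp : 1 < p := (Fact.out : p.Prime).one_lt
  intro h1
  refine h.not_pow ⟨z, mul_right_cancel₀ hz ?_⟩
  rw [← pow_succ, Nat.sub_add_cancel (Nat.one_le_pow _ _ (by omega)), ← h1, fr_natCast]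

theorem natCast_ne_zero_of_lt {k : ℕ} (h1 : 1 ≤ k) (h2 : k ≤ m - 1) : (k : ZMod m) ≠ 0 := by
  rw [Ne, ZMod.natCast_eq_zero_iff]
  intro h
  have := Nat.le_of_dvd (by omega) h
  have := NeZero.pos m
  omega

theorem two_mul_natCast_ne_zero {k : ℕ} (h1 : 1 ≤ k) (h2 : k ≤ m - 1) (h : 2 * k ≠ m) :
    2 * (k : ZMod m) ≠ 0 := by
  have e : (2 * (k : ZMod m)) = ((2 * k : ℕ) : ZMod m) := by push_cast; ring
  rw [e, Ne, ZMod.natCast_eq_zero_iff]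
  rintro ⟨c, hc⟩
  have hm := NeZero.pos m
  rcases c with _ | _ | c
  · omega
  · omega
  · have : m * 2 ≤ m * (c + 1 + 1) := Nat.mul_le_mul_left _ (by omega)
    omega

theorem natCast_eq_neg {k₁ k₂ : ℕ} (h : (k₂ : ℤ) ≡ -(k₁ : ℤ) [ZMOD m]) :
    (k₂ : ZMod m) = -(k₁ : ZMod m) := by
  have := (ZMod.intCast_eq_intCast_iff _ _ _).mpr h
  push_cast at this
  exact this

theorem fr_zero_or_one (i : ZMod m) {a : F} (ha : a = 0 ∨ a = 1) : fr F p i a = a := by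
  rcases ha with rfl | rfl <;> simp

theorem not_isotopic_of_ne {R : ℕ} [Fact R.Prime] (hord : orderOf (p : ZMod R) = m) (hm : 1 < m)
    {k₁ k₂ : ℕ} (hk : 2 * k₁ ≠ m) (h12 : ¬ (k₁ : ℤ) ≡ (k₂ : ℤ) [ZMOD m])
    (h12' : ¬ (k₁ : ℤ) ≡ -(k₂ : ℤ) [ZMOD m]) {α a b α' a' b' : F}
    (h₁ : IsTaniguchi p m k₁ α a b) (h₂ : IsTaniguchi p m k₂ α' a' b') :
    ¬ Isotopic p (taniguchiMul (p ^ k₁) α a b) (taniguchiMul (p ^ k₂) α' a' b') := by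
  intro h
  have h2 := two_mul_natCast_ne_zero h₁.one_le h₁.le_sub_one hk
  obtain ⟨i, N, L, M, hN⟩ := exists_linear_isotopism hord hm rfl h2 h₁.fr_ne h₁.ne_zero.1
    h₁.ne_zero.2 h
  refine not_isotopism_of_linear h₂.ne_zero.1 h₂.ne_zero.2 rfl rfl h2
    (natCast_ne_zero_of_lt h₂.one_le h₂.le_sub_one) (fun he => h12 ?_) (fun he => h12' ?_) hN
  · rw [← ZMod.intCast_eq_intCast_iff]; push_cast; exact he
  · rw [← ZMod.intCast_eq_intCast_iff]; push_cast; exact he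

theorem paramRel_of_isotopic {R : ℕ} [Fact R.Prime] (hord : orderOf (p : ZMod R) = m) (hm : 1 < m)
    {k : ℕ} (hk : 2 * k ≠ m) {α a b α' a' b' : F} (h₁ : IsTaniguchi p m k α a b)
    (h₂ : IsTaniguchi p m k α' a' b') (ha : a = 0 ∨ a = 1) (ha' : a' = 0 ∨ a' = 1)
    (h : Isotopic p (taniguchiMul (p ^ k) α a b) (taniguchiMul (p ^ k) α' a' b')) :
    ParamRel p (k : ZMod m) α a b α' a' b' := by
  have h2 := two_mul_natCast_ne_zero h₁.one_le h₁.le_sub_one hk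
  obtain ⟨i, N, L, M, hN⟩ := exists_linear_isotopism hord hm rfl h2 h₁.fr_ne h₁.ne_zero.1
    h₁.ne_zero.2 h
  rw [fr_zero_or_one i ha] at hN
  obtain ⟨j, ht, hab⟩ := paramRel_of_linear_isotopism (s := (k : ZMod m)) rfl h2 (fun z hz he => by
    refine h₁.fr_ne (m := m) (fr F p (-i) z) (by simpa using hz) ?_
    have := congrArg (fr F p (-i)) he
    rw [map_mul, map_neg, fr_neg_fr, ← fr_add, add_comm, fr_add] at this
    exact this) (by simpa using h₁.ne_zero.1) h₂.ne_zero.1 (by simpa using h₁.ne_zero.2)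
    h₂.ne_zero.2 ha ha' hN
  exact ⟨j + i, by simpa only [fr_add] using ht, by simpa only [fr_add] using hab⟩

theorem isotopic_of_paramRel {k : ℕ} {α a b α' a' b' : F}
    (h : ParamRel p (k : ZMod m) α a b α' a' b') :
    Isotopic p (taniguchiMul (p ^ k) α a b) (taniguchiMul (p ^ k) α' a' b') := by
  obtain ⟨i, ⟨u, hu, hα⟩, hab⟩ := h
  obtain ⟨s, hs⟩ : ∃ s : ZMod m, s = k := ⟨_, rfl⟩
  rw [← hs] at hα hab
  have hσu : fr F p s u ≠ 0 := by simpa using hu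
  have hσσu : fr F p s (fr F p s u) ≠ 0 := by simpa using hu
  have e : fr F p (2 * s) u = fr F p s (fr F p s u) := fr_two_mul s u
  have e1 : fr F p (2 * s) (fr F p s u) = fr F p s (fr F p s (fr F p s u)) := fr_two_mul s _
  have hα2 : fr F p (2 * s) α' * fr F p s (fr F p s (fr F p s u))
      = fr F p (2 * s) (fr F p i α) * fr F p s (fr F p s u) := by
    have := congrArg (fr F p (2 * s)) hα
    rwa [map_mul, map_mul, e, e1] at this
  -- The choices A' = A σ²(u), D' = D u satisfy the α-relations automatically, leaving only the
  -- conditions on a and b.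
  have key : ∀ A D : F, A ≠ 0 → D ≠ 0 → a' * fr F p s (D * u) = fr F p s (A * fr F p s u) * fr F p i a →
      b' * fr F p s D * D * u = fr F p s A * A * fr F p s (fr F p s u) * fr F p i b →
      Isotopic p (taniguchiMul (p ^ k) α a b) (taniguchiMul (p ^ k) α' a' b') := by
    intro A D hA hD h1 h2
    refine isotopic_of_diagRel hs i hA hD (mul_ne_zero hA hσσu) (mul_ne_zero hD hu) ?_ ?_
      ⟨_, rfl, ?_, ?_, ?_, ?_⟩
    · rw [map_mul]
      linear_combination D * fr F p s D * hα
    · have hα1 := congrArg (fr F p s) hα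
      simp only [map_mul] at h1 hα1
      linear_combination A * fr F p s (fr F p i α) * h1 + a' * fr F p s D * A * hα1
    · rw [map_mul]
      linear_combination A * fr F p s A * hα2
    · simp only [map_mul] at h1 ⊢
      linear_combination A * h1
    · linear_combination h2
    · rw [map_mul, e]; ring
  rcases hab with ⟨rfl, rfl, w, hw, rfl⟩ | ⟨rfl, rfl, rfl⟩
  · refine key (w * u / fr F p s u) 1 (by simp [hw, hu]) one_ne_zero (by simp) ?_
    simp only [map_mul, map_div₀, map_one]
    field_simp
  · refine key 1 (fr F p s u / u) one_ne_zero (by simp [hu]) ?_ ?_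
    · simp only [map_mul, map_div₀, map_one]; field_simp
    · simp only [map_div₀, map_one]; field_simp

/-- Applying σ⁻¹ to the first output coordinate and σ⁻² to the second replaces σ by σ⁻¹ while
exchanging which argument is semilinear; swapping the coordinates of both arguments restores the
shape. The parameters a', b' are kept, and α is the inverse of σ⁻¹(α'). -/
theorem exists_isotopic_of_eq_neg {k₁ k₂ : ℕ} (h1 : 1 ≤ k₁) (h1' : k₁ ≤ m - 1)
    (hk : (k₂ : ZMod m) = -(k₁ : ZMod m)) {α' a' b' : F} (h : IsTaniguchi p m k₂ α' a' b')
    (ha' : a' = 0 ∨ a' = 1) :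
    ∃ α : F, IsTaniguchi p m k₁ α a' b' ∧
      Isotopic p (taniguchiMul (p ^ k₁) α a' b') (taniguchiMul (p ^ k₂) α' a' b') := by
  obtain ⟨s, hs⟩ : ∃ s : ZMod m, s = k₁ := ⟨_, rfl⟩
  rw [← hs] at hk
  obtain ⟨hα', hb'⟩ := h.ne_zero
  have hp : 1 < p := (Fact.out : p.Prime).one_lt
  have hfr : ∀ z : F, z ≠ 0 → fr F p (-s) z ≠ -α' * z := by
    rw [← hk]; exact h.fr_ne
  have hroot : ∀ x : F, x * fr F p (-s) x + a' * x + b' ≠ 0 := fun x => by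
    have := h.no_root x
    rwa [pow_succ', ← fr_natCast (m := m), hk] at this
  have hα'' : fr F p (-s) α' ≠ 0 := by simpa using hα'
  have hσα' : fr F p s α' ≠ 0 := by simpa using hα'
  have hσb' : fr F p s b' ≠ 0 := by simpa using hb'
  set α := (fr F p (-s) α')⁻¹ with hα
  have hα0 : α ≠ 0 := inv_ne_zero hα''
  have hσα : fr F p s α = α'⁻¹ := by rw [hα, map_inv₀, fr_fr_neg]
  refine ⟨α, ⟨h1, h1', ?_, fun x hx => ?_⟩, ?_⟩
  · rintro ⟨z, hz⟩
    have h1p : 1 < p ^ k₁ := Nat.one_lt_pow (by omega) hp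
    have hz0 : z ≠ 0 := by
      rintro rfl
      rw [zero_pow (by omega)] at hz
      exact hα0 (by simpa using hz.symm)
    have hz' : fr F p s z = -α * z := by
      rw [← hz, hs, fr_natCast, ← pow_succ, Nat.sub_add_cancel h1p.le]
    refine hfr (fr F p s (fr F p s z)) (by simpa using hz0) ?_
    rw [fr_neg_fr]
    conv_rhs => rw [hz', map_mul, map_neg, hσα]
    field_simp
  · rw [pow_succ', ← fr_natCast (m := m), ← hs] at hx
    -- A root x satisfies x(σ(x) + a') = -b', so this is b'/x, a root for the opposite exponent.
    refine hroot (-(fr F p s x + a')) ?_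
    rw [map_neg, map_add, fr_neg_fr, fr_zero_or_one _ ha']
    linear_combination hx
  · set D := b' * α' * α with hD
    have hD0 : D ≠ 0 := mul_ne_zero (mul_ne_zero hb' hα') hα0
    set K := -(fr F p s b' * fr F p s α') with hK
    have hσD : fr F p s D = fr F p s b' * fr F p s α' * α'⁻¹ := by
      rw [hD, map_mul, map_mul, hσα]
    have hK0 : fr F p (-s) K ≠ 0 := by simp [hK, hb', hα']
    let S : (F × F) ≃ₗ[ZMod p] (F × F) :=
      (LinearEquiv.prodComm (ZMod p) F F).trans (frProd p (Units.mk0 D hD0) 1 (0 : ZMod m) 0)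
    have hS : ∀ X, S X = (D * X.2, X.1) := fun X => by
      simp [S, frProd_apply, fr_zero]
    refine ⟨frProd p (Units.mk0 _ hK0) (Units.mk0 D hD0) (-s) (-(2 * s)), S, S, fun X Y => ?_⟩
    rw [frProd_apply, taniguchiMul_eq (m := m), taniguchiMul_eq (m := m), hk, ← hs, hS, hS]
    have e1 : ∀ x : F, fr F p s (fr F p (2 * -s) x) = fr F p (-s) x := fun x => by
      rw [← fr_add]; congr 2; ring
    have e2 : ∀ x : F, fr F p (2 * s) (fr F p (2 * -s) x) = x := fun x => by
      rw [← fr_add, show 2 * s + 2 * -s = 0 by ring, fr_zero]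
    refine Prod.ext ((fr F p s).injective ?_) ((fr F p (2 * s)).injective ?_)
    · simp only [formP, formQ, map_mul, map_add, map_sub, fr_fr_neg, Units.val_mk0, e1,
        fr_zero_or_one _ ha', fr_two_mul s, hσα]
      have hα_inv : fr F p (-s) α' = α⁻¹ := by rw [hα, inv_inv]
      simp only [map_inv₀, hσD, hα_inv, hK]
      rw [hD]
      field_simp
      ring
    · simp only [formG, formH, map_mul, map_add, fr_fr_neg, Units.val_mk0, e2]
      ring

end Taniguchi
theorem theorem3 (p m : ℕ) [Fact p.Prime] (hpm : ¬ (p = 2 ∧ m = 6))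
    (F : Type*) [Field F] [Algebra (ZMod p) F] (hF : Nat.card F = p ^ m) :
    -- opposite exponents
    (∀ k₁ k₂ : ℕ, 1 ≤ k₁ → k₁ ≤ m - 1 → 2 * k₁ ≠ m → (k₂ : ℤ) ≡ -(k₁ : ℤ) [ZMOD m] →
      ∀ α' a' b' : F, IsTaniguchi p m k₂ α' a' b' → (a' = 0 ∨ a' = 1) →
        ∃ α a b : F, IsTaniguchi p m k₁ α a b ∧ (a = 0 ∨ a = 1) ∧
          Isotopic p (taniguchiMul (p ^ k₁) α a b) (taniguchiMul (p ^ k₂) α' a' b')) ∧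
    -- essentially different exponents
    (∀ k₁ k₂ : ℕ, 2 * k₁ ≠ m →
      ¬ (k₁ : ℤ) ≡ (k₂ : ℤ) [ZMOD m] → ¬ (k₁ : ℤ) ≡ -(k₂ : ℤ) [ZMOD m] →
      ∀ α a b α' a' b' : F, IsTaniguchi p m k₁ α a b → IsTaniguchi p m k₂ α' a' b' →
        (a = 0 ∨ a = 1) → (a' = 0 ∨ a' = 1) →
        ¬ Isotopic p (taniguchiMul (p ^ k₁) α a b) (taniguchiMul (p ^ k₂) α' a' b')) ∧
    -- equal exponents
    (∀ k : ℕ, 2 * k ≠ m →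
      ∀ α a b α' a' b' : F, IsTaniguchi p m k α a b → IsTaniguchi p m k α' a' b' →
        (a = 0 ∨ a = 1) → (a' = 0 ∨ a' = 1) →
        (Isotopic p (taniguchiMul (p ^ k) α a b) (taniguchiMul (p ^ k) α' a' b') ↔
          (a = 0 ∧ a' = 0 ∧ ∃ t : ℕ, t ≤ m - 1 ∧
            (∃ z : F, z ≠ 0 ∧ α ^ (p ^ t) / α' = z ^ (p ^ k - 1)) ∧
            (∃ w : F, w ≠ 0 ∧ b' ^ (p ^ (m - t)) / b = w ^ (p ^ k + 1))) ∨
          (a = 1 ∧ a' = 1 ∧ ∃ t : ℕ, t ≤ m - 1 ∧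
            (∃ z : F, z ≠ 0 ∧ α ^ (p ^ t) / α' = z ^ (p ^ k - 1)) ∧
            b = b' ^ (p ^ (m - t))))) := by
  have hp : 1 < p := (Fact.out : p.Prime).one_lt
  have : CharP F p := charP_of_injective_algebraMap (algebraMap (ZMod p) F).injective p
  have : Finite F := Nat.finite_of_card_ne_zero (by rw [hF]; exact pow_ne_zero _ (by omega))
  have : NeZero m := ⟨by
    rintro rfl
    have : 1 < Nat.card F := Finite.one_lt_card
    rw [hF, pow_zero] at this
    omega⟩
  have : Fact (Nat.card F = p ^ m) := ⟨hF⟩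
  -- The bounds on k with 2k ≠ m exclude m ≤ 2.
  have hR : ∀ k : ℕ, 1 ≤ k → k ≤ m - 1 → 2 * k ≠ m →
      ∃ R : ℕ, R.Prime ∧ orderOf (p : ZMod R) = m := fun k h1 h2 h3 =>
    exists_prime_orderOf_eq hp (by omega) hpm
  refine ⟨?_, ?_, ?_⟩
  · intro k₁ k₂ h1 h1' _ hk α' a' b' h ha'
    obtain ⟨α, hα, hiso⟩ := exists_isotopic_of_eq_neg h1 h1' (natCast_eq_neg hk) h ha'
    exact ⟨α, a', b', hα, ha', hiso⟩
  · intro k₁ k₂ hk h12 h12' α a b α' a' b' h₁ h₂ _ _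
    have := h₁.one_le
    have := h₁.le_sub_one
    obtain ⟨R, hR, hord⟩ := hR k₁ h₁.one_le h₁.le_sub_one hk
    have := Fact.mk hR
    exact not_isotopic_of_ne hord (by omega) hk h12 h12' h₁ h₂
  · intro k hk α a b α' a' b' h₁ h₂ ha ha'
    have hk1 := h₁.one_le
    have hk2 := h₁.le_sub_one
    obtain ⟨R, hR, hord⟩ := hR k h₁.one_le h₁.le_sub_one hk
    have := Fact.mk hR
    obtain ⟨hα0, hb0⟩ := h₁.ne_zero
    obtain ⟨hα0', hb0'⟩ := h₂.ne_zero
    have hdiv : ∀ x y z : F, y ≠ 0 → z ≠ 0 →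
        (x / y = z ^ (p ^ k - 1) ↔ y * fr F p (k : ZMod m) z = x * z) := by
      intro x y z hy hz
      rw [fr_natCast, div_eq_iff hy, ← mul_left_inj' hz, mul_right_comm, ← pow_succ,
        Nat.sub_add_cancel (Nat.one_le_pow _ _ (by omega)), mul_comm y, eq_comm]
    -- The exponent p^(m-t) inverts the twist by p^t; at t = 0 it is p^m, the identity on F.
    have hfr : ∀ t : ℕ, t ≤ m - 1 → ∀ x : F, x ^ p ^ (m - t) = fr F p (-(t : ZMod m)) x := by
      intro t ht x
      rw [← fr_natCast (m := m), Nat.cast_sub (by omega), ZMod.natCast_self, zero_sub]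
    constructor
    · intro h
      obtain ⟨i, ⟨u, hu, hα⟩, hab⟩ := paramRel_of_isotopic hord (by omega) hk h₁ h₂ ha ha' h
      have hi : i.val ≤ m - 1 := by have := ZMod.val_lt i; omega
      have hu' : α ^ p ^ i.val / α' = u ^ (p ^ k - 1) := (hdiv _ _ _ hα0' hu).mpr hα
      rcases hab with ⟨h0, h0', w, hw, hb⟩ | ⟨h1, h1', hb⟩
      · refine Or.inl ⟨h0, h0', i.val, hi, ⟨u, hu, hu'⟩, fr F p (-i) w, by simpa using hw, ?_⟩
        rw [hfr _ hi, ZMod.natCast_zmod_val, hb, map_mul, fr_neg_fr, mul_div_cancel_left₀ _ hb0,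
          fr_natCast, map_mul, map_pow, pow_succ]
      · refine Or.inr ⟨h1, h1', i.val, hi, ⟨u, hu, hu'⟩, ?_⟩
        rw [hfr _ hi, ZMod.natCast_zmod_val, hb, fr_neg_fr]
    · intro h
      apply isotopic_of_paramRel (m := m)
      rcases h with ⟨h0, h0', t, ht, ⟨z, hz, hz'⟩, w, hw, hb⟩ | ⟨h1, h1', t, ht, ⟨z, hz, hz'⟩, hb⟩
      · refine ⟨t, ⟨z, hz, ?_⟩, Or.inl ⟨h0, h0', fr F p (t : ZMod m) w, by simpa using hw, ?_⟩⟩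
        · rw [fr_natCast (k := t)]; exact (hdiv _ _ _ hα0' hz).mp hz'
        · rw [hfr t ht, div_eq_iff hb0, pow_succ, ← fr_natCast (m := m)] at hb
          have := congrArg (fr F p (t : ZMod m)) hb
          rw [fr_fr_neg, map_mul, map_mul] at this
          rw [this, ← fr_add, ← fr_add, add_comm]; ring
      · refine ⟨t, ⟨z, hz, ?_⟩, Or.inr ⟨h1, h1', ?_⟩⟩
        · rw [fr_natCast (k := t)]; exact (hdiv _ _ _ hα0' hz).mp hz'
        · rw [hb, hfr t ht, fr_fr_neg]
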